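/- Let $\mathcal P$ be a homogeneous Poisson point process on $\mathbb R$ with unit intensity, let $\alpha\in(0,\infty)$, and let $g\colon\mathbb R\to[0,1]$ be a measurable function with $g(x)=g(-x)$ for all $x$ and $\lim_{|x|\to\infty} g(x)/|x|^{-\alpha}=1$. For $n\in\mathbb N$ let $\mathcal P_n=\mathcal P\cap[-n,n]$ and let $(\mathcal P_n,E_n)$ be the soft random geometric graph with connection function $g$: given $\mathcal P_n$, each pair of distinct points $x,y\in\mathcal P_n$ is joined by an edge $\{x,y\}\in E_n$ with probability $g(x-y)$, independently of all other pairs. Let $e_n^*=\max_{\{x,y\}\in E_n}|x-y|$ be the length of the longest edge (with $e_n^*=0$ if there are no edges), and let $U$ be uniformly distributed on $(0,1)$. Then, as $n\to\infty$, the following convergences in distribution hold. (I) If $\alpha>2$, then $\exp\left(\frac{2n}{1-\alpha}(e_n^*)^{1-\alpha}\right)\xrightarrow{d}U$. (II) If $\alpha=2$, then $\dfrac{1}{h(e_n^*/n)}\xrightarrow{d}U$, where $h(x)=\frac{x}{2}\exp\left(\frac{2-x}{x}\right)$ for $x\in(0,2]$. (III) If $1<\alpha<2$, then $\exp\left(-(2n)^{\alpha-2}\,2^{-1}(2-\alpha)^{-2}\left((e_n^*)^{2-\alpha}-(2n)^{2-\alpha}\right)^2\right)\xrightarrow{d}U$.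 (IV) If $\alpha=1$, then $\exp\left(-n\left(\ln\frac{e_n^*}{2n}\right)^2\right)\xrightarrow{d}U$. (V) If $0<\alpha<1$, then $\exp\left(-(2n)^{\alpha}\,2^{-1}(1-\alpha)^{-2}\left((e_n^*)^{1-\alpha}-(2n)^{1-\alpha}\right)^2\right)\xrightarrow{d}U$. (On the event that there is no edge, whose probability tends to $0$, the values of these expressions are immaterial.) -/

import Mathlib

open MeasureTheory ProbabilityTheory Filter Topology

namespace SoftRGG

/-- A homogeneous Poisson point process on `ℝ` with unit intensity, viewed as a random locally
finite subset of `ℝ`: the number of points in a bounded Borel set `A` is a Poisson random variable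
with mean the Lebesgue measure of `A`, and the numbers of points in finitely many pairwise disjoint
bounded Borel sets are independent. -/
structure IsUnitPoissonProcess {Ω : Type*} [MeasurableSpace Ω] (μ : Measure Ω)
    (P : Ω → Set ℝ) : Prop where
  locally_finite : ∀ ω (R : ℝ), (P ω ∩ Set.Icc (-R) R).Finite
  measurable_count : ∀ A : Set ℝ, MeasurableSet A → Bornology.IsBounded A →
    Measurable fun ω => (P ω ∩ A).ncard
  law_count : ∀ A : Set ℝ, MeasurableSet A → Bornology.IsBounded A →
    μ.map (fun ω => (P ω ∩ A).ncard) = poissonMeasure (volume A).toNNReal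
  indep_count : ∀ (k : ℕ) (A : Fin k → Set ℝ), (∀ i, MeasurableSet (A i)) →
    (∀ i, Bornology.IsBounded (A i)) → Pairwise (fun i j => Disjoint (A i) (A j)) →
    iIndepFun (fun (i : Fin k) ω => (P ω ∩ A i).ncard) μ

/-- The points of the process in the window `B_n = [-n, n]`. -/
def window {Ω : Type*} (P : Ω → Set ℝ) (n : ℕ) (ω : Ω) : Set ℝ :=
  P ω ∩ Set.Icc (-(n : ℝ)) n

/-- The σ-algebra generated by a random finite subset `V` of `ℝ`, that is, by its counting
variables. -/
@[reducible]
noncomputable def sigmaPoints {Ω : Type*} (V : Ω → Set ℝ) : MeasurableSpace Ω :=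
  ⨆ (A : Set ℝ) (_ : MeasurableSet A),
    MeasurableSpace.comap (fun ω => (V ω ∩ A).ncard) ⊤

/-- The `i`-th smallest element (counting from `0`) of a finite set `S` of reals, meaningful for
`i < S.ncard`. -/
noncomputable def orderPoint (S : Set ℝ) (i : ℕ) : ℝ :=
  sInf {t : ℝ | i < (S ∩ Set.Iic t).ncard}

/-- The event that the `i`-th and the `j`-th smallest vertices exist and are joined by an edge
(used for `i < j`). -/
def edgeEvent {Ω : Type*} (V : Ω → Set ℝ) (E : Ω → Set (Sym2 ℝ)) (p : ℕ × ℕ) : Set Ω :=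
  {ω | p.2 < (V ω).ncard ∧ s(orderPoint (V ω) p.1, orderPoint (V ω) p.2) ∈ E ω}

/-- `(V, E)` is a soft random graph with (random, finite) vertex set `V` and connection function
`g`: edges join distinct points of `V` and, conditionally on `V`, each pair of points `x, y` of `V`
is joined with probability `g (x - y)`, independently of all other pairs. The pairs of points of `V`
are enumerated through the ordering of `ℝ`; conditional independence with the given conditional
probabilities is expressed by the product formula over all finite families of pairs. -/
structure IsSoftRandomGraph {Ω : Type*} [MeasurableSpace Ω] (μ : Measure Ω) (g : ℝ → ℝ)
    (V : Ω → Set ℝ) (E : Ω → Set (Sym2 ℝ)) : Prop where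
  edge_mem : ∀ ω, ∀ e ∈ E ω, ¬ e.IsDiag ∧ ∀ x ∈ e, x ∈ V ω
  measurable_edge : ∀ p : ℕ × ℕ, p.1 < p.2 → MeasurableSet (edgeEvent V E p)
  cond_prob : ∀ S : Finset (ℕ × ℕ), (∀ p ∈ S, p.1 < p.2) →
    μ⟦⋂ p ∈ S, edgeEvent V E p | sigmaPoints V⟧ =ᵐ[μ] fun ω =>
      ∏ p ∈ S, if p.2 < (V ω).ncard then
        g (orderPoint (V ω) p.1 - orderPoint (V ω) p.2) else 0

/-- The length of the longest edge of an edge set (and `0` if there are no edges). -/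
noncomputable def longestEdge (E : Set (Sym2 ℝ)) : ℝ :=
  sSup {d : ℝ | ∃ x y : ℝ, s(x, y) ∈ E ∧ d = |x - y|}

/-- The function `h` (of interest on `(0, 2]`). -/
noncomputable def h (x : ℝ) : ℝ := x / 2 * Real.exp ((2 - x) / x)

end SoftRGG

/-!
# The longest edge of a one-dimensional soft random geometric graph

Each of the five transforms of the longest edge is increasing in its argument, so that convergence
to the uniform law amounts to `P(e_n ≤ r_n) → u` for the threshold `r_n = r_n(u)` at which the
transform takes the value `u`. The probability that no edge is longer than `r` is a Poisson limit:
if the expected number of edges longer than `r_n`, which is `∫ t in r_n..2n, (2n - t) t^(-α)` to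
leading order, tends to `l`, and the expected number of such edges at a single vertex tends to `0`,
then `P(e_n ≤ r_n) → exp (-l)`. These conditions are collected in `IsCriticalScale`, and the limit
is `tendsto_measureReal_longestEdge_le`. In every regime the threshold satisfies them with
`l = -log u`.

For the Poisson limit, conditioning on the vertices gives
`P(e_n ≤ r) = E ∏ (1 - g (y - x))`, the product over the pairs of vertices with `y - x > r`
(`measureReal_longestEdge_le`). Since `g` is asymptotically a power, the factors hardly change when
the vertices move by a bounded amount. Dividing `[-n, n)` into unit cells, with point counts `N_a`,
the product therefore lies between two random variables of the form `exp (-∑ c (a, b) N_a N_b)`.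
The counts are independent Poisson variables of mean `1`, so the quadratic form has mean `∑ c` and
its variance is at most `12 (∑ c) D`, where `D` bounds the row and column sums of `c`: only pairs
of cells that share a cell are correlated. As `D → 0`, the expectation is close to `exp (-∑ c)`
(`abs_integral_exp_neg_quadratic_sub_le`), and the sums `∑ c` are compared with the integral above.

The thresholds depend on the regime. For `α < 2` the longest edge joins the two ends of the window:
`2n - r_n` is of order `n^(α/2)`, and `l` depends on `r_n` only through the limit of
`(2n - r_n) / (2n)^(α/2)` (`isCriticalScale_of_tendsto_div`). For `α = 2` the threshold is
proportional to `n` and the integral equals `log (h (r_n / n))`. For `α > 2` it is of order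
`n^(1/(α-1))`, much smaller than `n`.
-/

namespace SoftRGG

/-! ### Convergence in distribution to the uniform law -/

/-- Pointwise convergence of the distribution functions on `(0, 1)` suffices for convergence to the
uniform law: it extends to the whole line by monotonicity, and half-open intervals form a π-system
that contains small neighbourhoods of every point. -/
theorem tendstoInDistribution_uniform_of_tendsto_cdf {Ω Ω' : Type*} [MeasurableSpace Ω]
    [MeasurableSpace Ω'] {μ : Measure Ω} [IsProbabilityMeasure μ] {ν : Measure Ω'}
    [IsProbabilityMeasure ν] {T : ℕ → Ω → ℝ} (hT : ∀ n, Measurable (T n)) {U : Ω' → ℝ}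
    (hU : pdf.IsUniform U (Set.Ioo (0 : ℝ) 1) ν volume)
    (h : ∀ u ∈ Set.Ioo (0 : ℝ) 1, Tendsto (fun n => μ.real {ω | T n ω ≤ u}) atTop (𝓝 u)) :
    TendstoInDistribution T atTop U (fun _ => μ) ν := by
  have hUm : AEMeasurable U ν := hU.aemeasurable (by simp) (by simp)
  refine ⟨fun n => (hT n).aemeasurable, hUm, ?_⟩
  -- the distribution functions converge on the whole line, by monotonicity
  have hcdf : ∀ u : ℝ, Tendsto (fun n => μ.real {ω | T n ω ≤ u}) atTop
      (𝓝 (max 0 (min u 1))) := by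
    intro u
    have mono : ∀ n, ∀ a b : ℝ, a ≤ b → μ.real {ω | T n ω ≤ a} ≤ μ.real {ω | T n ω ≤ b} :=
      fun n a b hab => measureReal_mono (fun ω hω => le_trans hω hab)
    rcases le_or_gt u 0 with hu0 | hu0
    · rw [max_eq_left (le_trans (min_le_left _ _) hu0)]
      rw [tendsto_order]
      refine ⟨fun a ha => Eventually.of_forall fun n => ha.trans_le measureReal_nonneg, ?_⟩
      intro a ha
      have hm : min a 1 / 2 ∈ Set.Ioo (0 : ℝ) 1 := by
        have := lt_min ha one_pos; have := min_le_right a 1; constructor <;> linarith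
      filter_upwards [(h _ hm).eventually_lt_const (u := a)
        (by have := lt_min ha one_pos; have := min_le_left a 1; linarith)] with n hn
      exact (mono n _ _ (hu0.trans hm.1.le)).trans_lt hn
    rcases lt_or_ge u 1 with hu1 | hu1
    · rw [min_eq_left hu1.le, max_eq_right hu0.le]
      exact h u ⟨hu0, hu1⟩
    · rw [min_eq_right hu1, max_eq_right zero_le_one, tendsto_order]
      refine ⟨fun a ha => ?_, fun a ha => Eventually.of_forall fun n =>
        measureReal_le_one.trans_lt ha⟩
      have hm : (max a 0 + 1) / 2 ∈ Set.Ioo (0 : ℝ) 1 := by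
        have := max_lt ha one_pos; have := le_max_right a 0; constructor <;> linarith
      filter_upwards [(h _ hm).eventually_const_lt (u := a)
        (by have := max_lt ha one_pos; have := le_max_left a 0; linarith)] with n hn
      exact hn.trans_le (mono n _ _ (hm.2.le.trans hu1))
  have hπ : IsPiSystem {s : Set ℝ | ∃ a b : ℝ, s = Set.Ioc a b} := by
    rintro _ ⟨a, b, rfl⟩ _ ⟨c, d, rfl⟩ -
    exact ⟨_, _, Set.Ioc_inter_Ioc⟩
  refine hπ.tendsto_probabilityMeasure_of_tendsto_of_mem ?_ ?_ ?_
  · rintro _ ⟨a, b, rfl⟩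
    exact measurableSet_Ioc
  · intro u hu x hx
    obtain ⟨ε, hε, hb⟩ := Metric.isOpen_iff.1 hu x hx
    refine ⟨Set.Ioc (x - ε / 2) (x + ε / 2), ⟨_, _, rfl⟩,
      Ioc_mem_nhds (by linarith) (by linarith), fun y hy => hb ?_⟩
    rw [Metric.mem_ball, Real.dist_eq, abs_lt]
    constructor <;> linarith [hy.1, hy.2]
  · rintro _ ⟨a, b, rfl⟩
    rw [← NNReal.tendsto_coe]
    have hlim : (ν.map U).real (Set.Ioc a b) =
        if a ≤ b then max 0 (min b 1) - max 0 (min a 1) else 0 := by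
      rw [hU, measureReal_def, ProbabilityTheory.cond_apply measurableSet_Ioo]
      have : volume (Set.Ioo (0 : ℝ) 1 ∩ Set.Ioc a b) =
          volume (Set.Ioc (max 0 a) (min 1 b)) := by
        rw [← Set.Ioc_inter_Ioc]
        exact measure_congr (Ioo_ae_eq_Ioc.inter (ae_eq_refl _))
      rw [this]
      simp only [Real.volume_Ioo, Real.volume_Ioc, sub_zero, ENNReal.ofReal_one, inv_one, one_mul]
      rw [ENNReal.toReal_ofReal']
      split_ifs with hab
      · grind
      · grind
    have hleft : ∀ n, (μ.map (T n)).real (Set.Ioc a b) =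
        if a ≤ b then μ.real {ω | T n ω ≤ b} - μ.real {ω | T n ω ≤ a} else 0 := by
      intro n
      split_ifs with hab
      · have hsub : {ω | T n ω ≤ a} ⊆ {ω | T n ω ≤ b} := fun ω hω => le_trans hω hab
        rw [map_measureReal_apply (hT n) measurableSet_Ioc,
          ← measureReal_sdiff hsub (measurableSet_le (hT n) measurable_const)]
        congr 1
        ext ω
        simp [and_comm]
      · rw [Set.Ioc_eq_empty (fun h => hab h.le)]; simp
    change Tendsto (fun n => (μ.map (T n)).real (Set.Ioc a b)) atTop
      (𝓝 ((ν.map U).real (Set.Ioc a b)))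
    rw [hlim]
    simp only [hleft]
    split_ifs with hab
    · exact (hcdf b).sub (hcdf a)
    · exact tendsto_const_nhds

/-- If `φ n` is, on `(0, b n]`, an increasing transform whose sublevel sets `{φ n ≤ u}` are
`{x ≤ r n}`, with `P(e n ≤ r n) → u`, then `φ n (e n)` converges to the uniform law. The values of
`φ n` on `(-∞, 0]` do not matter, because `P(e n ≤ 0) ≤ P(e n ≤ r n)` for every choice of `u`. -/
theorem tendstoInDistribution_uniform_of_monotone_transform {Ω Ω' : Type*} [MeasurableSpace Ω]
    [MeasurableSpace Ω'] {μ : Measure Ω} [IsProbabilityMeasure μ] {ν : Measure Ω'}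
    [IsProbabilityMeasure ν] {e : ℕ → Ω → ℝ} (he : ∀ n, Measurable (e n))
    {b : ℕ → ℝ} (heb : ∀ n ω, e n ω ≤ b n) {φ : ℕ → ℝ → ℝ}
    (hφ : ∀ n, Measurable (φ n)) {U : Ω' → ℝ}
    (hU : pdf.IsUniform U (Set.Ioo (0 : ℝ) 1) ν volume)
    (h : ∀ u ∈ Set.Ioo (0 : ℝ) 1, ∃ r : ℕ → ℝ,
      Tendsto (fun n => μ.real {ω | e n ω ≤ r n}) atTop (𝓝 u) ∧
      (∀ᶠ n in atTop, 0 ≤ r n) ∧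
      ∀ᶠ n in atTop, ∀ x, 0 < x → x ≤ b n → (φ n x ≤ u ↔ x ≤ r n)) :
    TendstoInDistribution (fun n ω => φ n (e n ω)) atTop U (fun _ => μ) ν := by
  have h0 : Tendsto (fun n => μ.real {ω | e n ω ≤ 0}) atTop (𝓝 0) := by
    rw [tendsto_order]
    refine ⟨fun a ha => Eventually.of_forall fun n => ha.trans_le measureReal_nonneg, ?_⟩
    intro a ha
    have hm : min a 1 / 2 ∈ Set.Ioo (0 : ℝ) 1 := by
      have := lt_min ha one_pos; have := min_le_right a 1; constructor <;> linarith
    obtain ⟨r, hr, hr0, -⟩ := h _ hm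
    filter_upwards [hr0, hr.eventually_lt_const (u := a)
      (by have := lt_min ha one_pos; have := min_le_left a 1; linarith)] with n hn0 hn
    exact (measureReal_mono (fun ω hω => le_trans hω hn0)).trans_lt hn
  refine tendstoInDistribution_uniform_of_tendsto_cdf (fun n => (hφ n).comp (he n)) hU ?_
  intro u hu
  obtain ⟨r, hr, hr0, hrφ⟩ := h u hu
  have hd : Tendsto (fun n => μ.real {ω | φ n (e n ω) ≤ u} - μ.real {ω | e n ω ≤ r n})
      atTop (𝓝 0) := by
    refine squeeze_zero_norm' ?_ h0
    filter_upwards [hrφ] with n hn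
    have hiff : ∀ ω, ¬ e n ω ≤ 0 → (φ n (e n ω) ≤ u ↔ e n ω ≤ r n) :=
      fun ω hω => hn _ (not_le.1 hω) (heb n ω)
    rw [Real.norm_eq_abs, abs_sub_le_iff]
    constructor
    · rw [sub_le_iff_le_add]
      refine (measureReal_mono (fun ω hω => ?_)).trans
        (measureReal_union_le {ω | e n ω ≤ 0} {ω | e n ω ≤ r n})
      by_cases h : e n ω ≤ 0
      · exact Or.inl h
      · exact Or.inr ((hiff ω h).1 hω)
    · rw [sub_le_iff_le_add]
      refine (measureReal_mono (fun ω hω => ?_)).trans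
        (measureReal_union_le {ω | e n ω ≤ 0} {ω | φ n (e n ω) ≤ u})
      by_cases h : e n ω ≤ 0
      · exact Or.inl h
      · exact Or.inr ((hiff ω h).2 hω)
  simpa using hd.add hr

/-! ### Order points and the longest edge -/

section OrderPoint

/-- The first `i + 1` points of `s` lie below `t` as soon as the `i`-th one does. -/
theorem lt_ncard_inter_Iic_iff (s : Finset ℝ) (i : Fin s.card) (t : ℝ) :
    (i : ℕ) < ((s : Set ℝ) ∩ Set.Iic t).ncard ↔ s.orderEmbOfFin rfl i ≤ t := by
  classical
  have hcard : ((s : Set ℝ) ∩ Set.Iic t).ncard = (s.filter (· ≤ t)).card := by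
    rw [← Set.ncard_coe_finset]
    congr 1
    ext x
    simp
  rw [hcard]
  constructor
  · intro h
    by_contra! hlt
    have hsub : s.filter (· ≤ t) ⊆ (Finset.Iio i).image (s.orderEmbOfFin rfl) := by
      intro x hx
      rw [Finset.mem_filter] at hx
      obtain ⟨j, rfl⟩ : x ∈ Set.range (s.orderEmbOfFin rfl) := by
        rw [Finset.range_orderEmbOfFin]; exact hx.1
      refine Finset.mem_image_of_mem _ (Finset.mem_Iio.2 ?_)
      exact (s.orderEmbOfFin rfl).lt_iff_lt.1 (hx.2.trans_lt hlt)
    have := (Finset.card_le_card hsub).trans Finset.card_image_le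
    rw [Fin.card_Iio] at this
    omega
  · intro h
    have hsub : (Finset.Iic i).image (s.orderEmbOfFin rfl) ⊆ s.filter (· ≤ t) := by
      intro x hx
      obtain ⟨j, hj, rfl⟩ := Finset.mem_image.1 hx
      rw [Finset.mem_filter]
      exact ⟨s.orderEmbOfFin_mem rfl j,
        ((s.orderEmbOfFin rfl).le_iff_le.2 (Finset.mem_Iic.1 hj)).trans h⟩
    have := Finset.card_le_card hsub
    rw [Finset.card_image_of_injective _ (s.orderEmbOfFin rfl).injective, Fin.card_Iic] at this
    omega

theorem orderPoint_coe (s : Finset ℝ) (i : Fin s.card) :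
    orderPoint (s : Set ℝ) i = s.orderEmbOfFin rfl i := by
  rw [orderPoint]
  simp only [lt_ncard_inter_Iic_iff]
  exact csInf_Ici

variable {S : Set ℝ}

theorem orderPoint_toFinset (hS : S.Finite) (i : Fin hS.toFinset.card) :
    orderPoint S i = hS.toFinset.orderEmbOfFin rfl i := by
  rw [← orderPoint_coe, hS.coe_toFinset]

theorem orderPoint_mem (hS : S.Finite) {i : ℕ} (hi : i < S.ncard) : orderPoint S i ∈ S := by
  rw [Set.ncard_eq_toFinset_card S hS] at hi
  rw [orderPoint_toFinset hS ⟨i, hi⟩]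
  exact hS.mem_toFinset.1 (Finset.orderEmbOfFin_mem _ _ _)

theorem orderPoint_lt (hS : S.Finite) {i j : ℕ} (hij : i < j) (hj : j < S.ncard) :
    orderPoint S i < orderPoint S j := by
  rw [Set.ncard_eq_toFinset_card S hS] at hj
  rw [orderPoint_toFinset hS ⟨i, hij.trans hj⟩, orderPoint_toFinset hS ⟨j, hj⟩]
  exact (hS.toFinset.orderEmbOfFin rfl).lt_iff_lt.2 hij

theorem orderPoint_le (hS : S.Finite) {i j : ℕ} (hij : i ≤ j) (hj : j < S.ncard) :
    orderPoint S i ≤ orderPoint S j := by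
  rcases hij.eq_or_lt with rfl | h
  · exact le_rfl
  · exact (orderPoint_lt hS h hj).le

theorem exists_orderPoint_eq (hS : S.Finite) {x : ℝ} (hx : x ∈ S) :
    ∃ i < S.ncard, orderPoint S i = x := by
  obtain ⟨i, hi⟩ : x ∈ Set.range (hS.toFinset.orderEmbOfFin rfl) := by
    rw [Finset.range_orderEmbOfFin, hS.coe_toFinset]; exact hx
  refine ⟨i, ?_, (orderPoint_toFinset hS i).trans hi⟩
  rw [Set.ncard_eq_toFinset_card S hS]
  exact i.2

/-- For `i ≥ S.ncard`, `orderPoint S i` is the infimum of the empty set, hence `0`. -/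
theorem orderPoint_le_iff (hS : S.Finite) (i : ℕ) (t : ℝ) :
    orderPoint S i ≤ t ↔
      (i < S.ncard ∧ i < (S ∩ Set.Iic t).ncard) ∨ (S.ncard ≤ i ∧ 0 ≤ t) := by
  rcases lt_or_ge i S.ncard with hi | hi
  · have hi' := hi
    rw [Set.ncard_eq_toFinset_card S hS] at hi'
    have h := lt_ncard_inter_Iic_iff hS.toFinset ⟨i, hi'⟩ t
    rw [hS.coe_toFinset, ← orderPoint_toFinset hS] at h
    simp only [hi, true_and, not_le.2 hi, false_and, or_false]
    exact h.symm
  · have h0 : orderPoint S i = 0 := by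
      rw [orderPoint]
      have : {t : ℝ | i < (S ∩ Set.Iic t).ncard} = ∅ := by
        ext t
        simpa using (Set.ncard_le_ncard Set.inter_subset_left hS).trans hi
      rw [this, Real.sInf_empty]
    simp [h0, hi, not_lt.2 hi]

theorem prod_orderPoint (hS : S.Finite) (F : ℝ → ℝ) :
    ∏ x ∈ hS.toFinset, F x = ∏ i ∈ Finset.range S.ncard, F (orderPoint S i) := by
  symm
  refine Finset.prod_bij (fun i _ => orderPoint S i) ?_ ?_ ?_ ?_
  · intro i hi
    exact hS.mem_toFinset.2 (orderPoint_mem hS (Finset.mem_range.1 hi))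
  · intro i hi j hj h
    rw [Finset.mem_range] at hi hj
    rcases lt_trichotomy i j with hij | hij | hij
    · exact absurd h (orderPoint_lt hS hij hj).ne
    · exact hij
    · exact absurd h (orderPoint_lt hS hij hi).ne'
  · intro x hx
    obtain ⟨i, hi, h⟩ := exists_orderPoint_eq hS (hS.mem_toFinset.1 hx)
    exact ⟨i, Finset.mem_range.2 hi, h⟩
  · intros; rfl

end OrderPoint

section LongestEdge

variable {Ω : Type*} {V : Ω → Set ℝ} {E : Ω → Set (Sym2 ℝ)}

theorem measurable_sigmaPoints_ncard {A : Set ℝ} (hA : MeasurableSet A) :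
    Measurable[sigmaPoints V] fun ω => (V ω ∩ A).ncard :=
  Measurable.of_comap_le (le_iSup₂_of_le A hA le_rfl)

theorem measurable_sigmaPoints_ncard_univ : Measurable[sigmaPoints V] fun ω => (V ω).ncard := by
  simpa using measurable_sigmaPoints_ncard (V := V) MeasurableSet.univ

theorem measurable_sigmaPoints_orderPoint (hV : ∀ ω, (V ω).Finite) (i : ℕ) :
    Measurable[sigmaPoints V] fun ω => orderPoint (V ω) i := by
  let := sigmaPoints V
  refine measurable_of_Iic fun t => ?_
  have : (fun ω => orderPoint (V ω) i) ⁻¹' Set.Iic t =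
      ((fun ω => (V ω).ncard) ⁻¹' Set.Ioi i ∩ (fun ω => (V ω ∩ Set.Iic t).ncard) ⁻¹' Set.Ioi i) ∪
      ((fun ω => (V ω).ncard) ⁻¹' {k | k ≤ i ∧ 0 ≤ t}) := by
    ext ω
    simp [orderPoint_le_iff (hV ω)]
  rw [this]
  have h1 := measurable_sigmaPoints_ncard_univ (V := V)
  have h2 := measurable_sigmaPoints_ncard (V := V) (measurableSet_Iic (a := t))
  exact ((h1 (MeasurableSet.of_discrete)).inter (h2 (MeasurableSet.of_discrete))).union
    (h1 (MeasurableSet.of_discrete))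

theorem longestEdge_nonneg (E : Set (Sym2 ℝ)) : 0 ≤ longestEdge E :=
  Real.sSup_nonneg fun _ ⟨_, _, _, h⟩ => h ▸ abs_nonneg _

/-- The longest edge in terms of the countable family of edge events. -/
theorem longestEdge_le_iff (hV : ∀ ω, (V ω).Finite)
    (hE : ∀ ω, ∀ e ∈ E ω, ¬ e.IsDiag ∧ ∀ x ∈ e, x ∈ V ω) {r : ℝ} (hr : 0 ≤ r) (ω : Ω) :
    longestEdge (E ω) ≤ r ↔ ∀ p : ℕ × ℕ, p.1 < p.2 → ω ∈ edgeEvent V E p →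
      orderPoint (V ω) p.2 - orderPoint (V ω) p.1 ≤ r := by
  have hmem : ∀ x y, s(x, y) ∈ E ω → x ≠ y ∧ x ∈ V ω ∧ y ∈ V ω := by
    intro x y hxy
    have := hE ω _ hxy
    exact ⟨by simpa using this.1, this.2 x (by simp), this.2 y (by simp)⟩
  constructor
  · intro h p hp hω
    refine le_trans ?_ h
    refine (le_abs_self _).trans ((abs_sub_comm _ _).trans_le (le_csSup ?_ ⟨_, _, hω.2, rfl⟩))
    refine (((hV ω).prod (hV ω)).image fun q : ℝ × ℝ => |q.1 - q.2|).bddAbove.mono ?_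
    rintro d ⟨x, y, hxy, rfl⟩
    exact ⟨(x, y), (hmem x y hxy).2, rfl⟩
  · intro h
    refine Real.sSup_le ?_ hr
    rintro d ⟨x, y, hxy, rfl⟩
    obtain ⟨hne, hx, hy⟩ := hmem x y hxy
    obtain ⟨i, hi, rfl⟩ := exists_orderPoint_eq (hV ω) hx
    obtain ⟨j, hj, rfl⟩ := exists_orderPoint_eq (hV ω) hy
    rcases lt_trichotomy i j with hij | hij | hij
    · rw [abs_sub_comm, abs_of_pos (sub_pos.2 (orderPoint_lt (hV ω) hij hj))]
      exact h (i, j) hij ⟨hj, hxy⟩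
    · exact absurd (by rw [hij]) hne
    · rw [abs_of_pos (sub_pos.2 (orderPoint_lt (hV ω) hij hi))]
      exact h (j, i) hij ⟨hi, by rwa [Sym2.eq_swap]⟩

theorem longestEdge_le_of_subset_Icc (hE : ∀ ω, ∀ e ∈ E ω, ¬ e.IsDiag ∧ ∀ x ∈ e, x ∈ V ω)
    {a : ℝ} (ha : 0 ≤ a) {ω : Ω} (hω : V ω ⊆ Set.Icc (-a) a) : longestEdge (E ω) ≤ 2 * a := by
  refine Real.sSup_le ?_ (by linarith)
  rintro d ⟨x, y, hxy, rfl⟩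
  have hx := hω ((hE ω _ hxy).2 x (by simp))
  have hy := hω ((hE ω _ hxy).2 y (by simp))
  rw [abs_le]
  constructor <;> linarith [hx.1, hx.2, hy.1, hy.2]

variable [MeasurableSpace Ω]

theorem sigmaPoints_le (hcount : ∀ A, MeasurableSet A → Measurable fun ω => (V ω ∩ A).ncard) :
    sigmaPoints V ≤ ‹MeasurableSpace Ω› :=
  iSup₂_le fun A hA => (hcount A hA).comap_le

theorem measurable_longestEdge (hV : ∀ ω, (V ω).Finite)
    (hcount : ∀ A, MeasurableSet A → Measurable fun ω => (V ω ∩ A).ncard)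
    {μ : Measure Ω} {g : ℝ → ℝ} (hE : IsSoftRandomGraph μ g V E) :
    Measurable fun ω => longestEdge (E ω) := by
  refine measurable_of_Iic fun t => ?_
  rcases lt_or_ge t 0 with ht | ht
  · have : (fun ω => longestEdge (E ω)) ⁻¹' Set.Iic t = ∅ := by
      ext ω
      simpa using ht.trans_le (longestEdge_nonneg _)
    rw [this]
    exact MeasurableSet.empty
  · have : (fun ω => longestEdge (E ω)) ⁻¹' Set.Iic t = ⋂ p : ℕ × ℕ, ⋂ _ : p.1 < p.2,
        (edgeEvent V E p)ᶜ ∪ {ω | orderPoint (V ω) p.2 - orderPoint (V ω) p.1 ≤ t} := by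
      ext ω
      simp only [Set.mem_preimage, Set.mem_Iic, longestEdge_le_iff hV hE.edge_mem ht,
        Set.mem_iInter, Set.mem_union, Set.mem_compl_iff, Set.mem_ofPred_eq, imp_iff_not_or]
    rw [this]
    have hX : ∀ i, Measurable fun ω => orderPoint (V ω) i := fun i =>
      (measurable_sigmaPoints_orderPoint hV i).mono (sigmaPoints_le hcount) le_rfl
    exact MeasurableSet.iInter fun p => MeasurableSet.iInter fun hp =>
      (hE.measurable_edge p hp).compl.union
        (measurableSet_le ((hX _).sub (hX _)) measurable_const)

end LongestEdge

/-! ### Conditioning on the vertices -/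

/-- The conditional probability that a pair of vertices at signed distance `τ` is not joined by
an edge longer than `r`. Only one orientation of each pair, the one with `r < τ`, contributes. -/
noncomputable def avoidProb (g : ℝ → ℝ) (r τ : ℝ) : ℝ := if r < τ then 1 - g τ else 1

section Conditioning

variable {Ω : Type*} {V : Ω → Set ℝ} {E : Ω → Set (Sym2 ℝ)} [MeasurableSpace Ω]
  {μ : Measure Ω} [IsProbabilityMeasure μ] {g : ℝ → ℝ}

/-- Inside an integral, against a weight depending on the vertices only, the indicator that all
pairs of `S` are joined may be replaced by its conditional probability. -/
theorem integral_mul_indicator_edgeEvent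
    (hcount : ∀ A, MeasurableSet A → Measurable fun ω => (V ω ∩ A).ncard)
    (hE : IsSoftRandomGraph μ g V E) {S : Finset (ℕ × ℕ)} (hS : ∀ p ∈ S, p.1 < p.2)
    {F : Ω → ℝ} (hF : Measurable[sigmaPoints V] F) {C : ℝ} (hFC : ∀ ω, |F ω| ≤ C) :
    ∫ ω, F ω * (⋂ p ∈ S, edgeEvent V E p).indicator (fun _ => (1 : ℝ)) ω ∂μ =
      ∫ ω, F ω * ∏ p ∈ S, (if p.2 < (V ω).ncard then
        g (orderPoint (V ω) p.1 - orderPoint (V ω) p.2) else 0) ∂μ := by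
  have hm := sigmaPoints_le hcount
  have hmeas : MeasurableSet (⋂ p ∈ S, edgeEvent V E p) :=
    S.measurableSet_biInter fun p hp => hE.measurable_edge p (hS p hp)
  have hint : Integrable ((⋂ p ∈ S, edgeEvent V E p).indicator (fun _ => (1 : ℝ))) μ :=
    (integrable_const _).indicator hmeas
  have hpull := condExp_stronglyMeasurable_mul_of_bound hm hF.stronglyMeasurable hint C
    (Eventually.of_forall hFC)
  calc _ = ∫ ω, (μ[F * (⋂ p ∈ S, edgeEvent V E p).indicator (fun _ => (1 : ℝ)) |
            sigmaPoints V]) ω ∂μ := (integral_condExp hm).symm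
    _ = _ := by
        refine integral_congr_ae ?_
        filter_upwards [hpull, hE.cond_prob S hS] with ω h1 h2
        rw [h1, Pi.mul_apply, h2]

/-- The probability that no pair of the finite family `S` is joined by an edge longer than `r`, by
inclusion-exclusion over the subfamilies of `S`, for which the conditional probabilities are known. -/
theorem measureReal_forall_edgeEvent (hV : ∀ ω, (V ω).Finite)
    (hcount : ∀ A, MeasurableSet A → Measurable fun ω => (V ω ∩ A).ncard)
    (hg : Measurable g) (hg_mem : ∀ x, g x ∈ Set.Icc (0 : ℝ) 1)
    (hE : IsSoftRandomGraph μ g V E) (r : ℝ) {S : Finset (ℕ × ℕ)} (hS : ∀ p ∈ S, p.1 < p.2) :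
    μ.real {ω | ∀ p ∈ S, ω ∈ edgeEvent V E p →
        orderPoint (V ω) p.2 - orderPoint (V ω) p.1 ≤ r} =
      ∫ ω, ∏ p ∈ S, (1 - if p.2 < (V ω).ncard ∧
          r < orderPoint (V ω) p.2 - orderPoint (V ω) p.1 then
        g (orderPoint (V ω) p.1 - orderPoint (V ω) p.2) else 0) ∂μ := by
  classical
  have hm := sigmaPoints_le hcount
  have hX := measurable_sigmaPoints_orderPoint (V := V) hV
  have hN := measurable_sigmaPoints_ncard_univ (V := V)
  set a : ℕ × ℕ → Ω → ℝ := fun p ω => if p.2 < (V ω).ncard ∧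
          r < orderPoint (V ω) p.2 - orderPoint (V ω) p.1 then 1 else 0 with ha
  set q : ℕ × ℕ → Ω → ℝ := fun p ω => if p.2 < (V ω).ncard then
          g (orderPoint (V ω) p.1 - orderPoint (V ω) p.2) else 0 with hq
  have ham : ∀ p, Measurable[sigmaPoints V] (a p) := by
    intro p
    let := sigmaPoints V
    refine Measurable.ite ?_ measurable_const measurable_const
    exact (measurableSet_lt measurable_const hN).inter
      (measurableSet_lt measurable_const ((hX _).sub (hX _)))
  have hqm : ∀ p, Measurable[sigmaPoints V] (q p) := by
    intro p
    let := sigmaPoints V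
    exact Measurable.ite (measurableSet_lt measurable_const hN)
      (hg.comp ((hX _).sub (hX _))) measurable_const
  have ha1 : ∀ p ω, |a p ω| ≤ 1 := by
    intro p ω
    simp only [ha]
    split_ifs <;> simp
  have hq1 : ∀ p ω, |q p ω| ≤ 1 := by
    intro p ω
    simp only [hq]
    split_ifs
    · rw [abs_le]; exact ⟨by linarith [(hg_mem (orderPoint (V ω) p.1 - orderPoint (V ω) p.2)).1],
        (hg_mem _).2⟩
    · simp
  have hFb : ∀ (T : Finset (ℕ × ℕ)) ω, |∏ p ∈ T, -a p ω| ≤ 1 := by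
    intro T ω
    rw [Finset.abs_prod]
    exact Finset.prod_le_one (fun _ _ => abs_nonneg _) fun p _ => by rw [abs_neg]; exact ha1 p ω
  have hFm : ∀ T : Finset (ℕ × ℕ), Measurable[sigmaPoints V] fun ω => ∏ p ∈ T, -a p ω := by
    intro T
    let := sigmaPoints V
    exact Finset.measurable_prod _ fun p _ => (ham p).neg
  have hset : MeasurableSet {ω | ∀ p ∈ S, ω ∈ edgeEvent V E p →
        orderPoint (V ω) p.2 - orderPoint (V ω) p.1 ≤ r} := by
    have : {ω | ∀ p ∈ S, ω ∈ edgeEvent V E p →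
        orderPoint (V ω) p.2 - orderPoint (V ω) p.1 ≤ r} = ⋂ p ∈ S,
        (edgeEvent V E p)ᶜ ∪ {ω | orderPoint (V ω) p.2 - orderPoint (V ω) p.1 ≤ r} := by
      ext ω
      simp only [Set.mem_iInter, Set.mem_union, Set.mem_compl_iff, Set.mem_ofPred_eq,
        imp_iff_not_or]
    rw [this]
    exact S.measurableSet_biInter fun p hp => (hE.measurable_edge p (hS p hp)).compl.union
      (measurableSet_le (((hX _).sub (hX _)).mono hm le_rfl) measurable_const)
  rw [← integral_indicator_one hset]
  -- expand the indicator of the event over the subfamilies of edges that are present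
  have hL : ∀ ω, {ω | ∀ p ∈ S, ω ∈ edgeEvent V E p →
        orderPoint (V ω) p.2 - orderPoint (V ω) p.1 ≤ r}.indicator (1 : Ω → ℝ) ω =
      ∑ T ∈ S.powerset, (∏ p ∈ T, -a p ω) *
        (⋂ p ∈ T, edgeEvent V E p).indicator (fun _ => (1 : ℝ)) ω := by
    intro ω
    have h1 : {ω | ∀ p ∈ S, ω ∈ edgeEvent V E p →
        orderPoint (V ω) p.2 - orderPoint (V ω) p.1 ≤ r}.indicator (1 : Ω → ℝ) ω =
        ∏ p ∈ S, (1 + -a p ω * (edgeEvent V E p).indicator (fun _ => (1 : ℝ)) ω) := by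
      by_cases hω : ∀ p ∈ S, ω ∈ edgeEvent V E p →
        orderPoint (V ω) p.2 - orderPoint (V ω) p.1 ≤ r
      · rw [Set.indicator_of_mem (by exact hω), Finset.prod_eq_one]
        · rfl
        · intro p hp
          by_cases hpe : ω ∈ edgeEvent V E p
          · have : a p ω = 0 := by
              simp only [ha]
              rw [if_neg]
              exact fun h => absurd (hω p hp hpe) (not_le.2 h.2)
            rw [this]; simp
          · simp [hpe]
      · rw [Set.indicator_of_notMem (by exact hω)]
        push Not at hω
        obtain ⟨p, hp, hpe, hlt⟩ := hω
        symm
        refine Finset.prod_eq_zero hp ?_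
        have : a p ω = 1 := by
          simp only [ha]
          exact if_pos ⟨hpe.1, hlt⟩
        rw [this]; simp [hpe]
    rw [h1, Finset.prod_one_add]
    refine Finset.sum_congr rfl fun T _ => ?_
    rw [Finset.prod_mul_distrib]
    congr 1
    by_cases hω : ω ∈ ⋂ p ∈ T, edgeEvent V E p
    · rw [Set.indicator_of_mem hω]
      simp only [Set.mem_iInter] at hω
      exact Finset.prod_eq_one fun p hp => by simp [hω p hp]
    · rw [Set.indicator_of_notMem hω]
      simp only [Set.mem_iInter, not_forall] at hω
      obtain ⟨p, hp, hpe⟩ := hω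
      exact Finset.prod_eq_zero hp (by simp [hpe])
  have hR : ∀ ω, ∏ p ∈ S, (1 - if p.2 < (V ω).ncard ∧
          r < orderPoint (V ω) p.2 - orderPoint (V ω) p.1 then
        g (orderPoint (V ω) p.1 - orderPoint (V ω) p.2) else 0) =
      ∑ T ∈ S.powerset, (∏ p ∈ T, -a p ω) * ∏ p ∈ T, q p ω := by
    intro ω
    simp_rw [← Finset.prod_mul_distrib]
    rw [← Finset.prod_one_add]
    refine Finset.prod_congr rfl fun p _ => ?_
    simp only [ha, hq]
    by_cases h1 : p.2 < (V ω).ncard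
    · by_cases h2 : r < orderPoint (V ω) p.2 - orderPoint (V ω) p.1 <;>
        (simp [h1, h2]; try ring)
    · simp [h1]
  simp_rw [hL, hR]
  rw [integral_finsetSum, integral_finsetSum]
  · refine Finset.sum_congr rfl fun T hT => ?_
    exact integral_mul_indicator_edgeEvent hcount hE
      (fun p hp => hS p (Finset.mem_powerset.1 hT hp)) (hFm T) (hFb T)
  · intro T _
    refine Integrable.of_bound (C := 1) ?_ (Eventually.of_forall fun ω => ?_)
    · exact (((hFm T).mono hm le_rfl).mul (Finset.measurable_prod _ fun p _ =>
        (hqm p).mono hm le_rfl)).aestronglyMeasurable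
    · rw [Real.norm_eq_abs, abs_mul]
      refine mul_le_one₀ (hFb T ω) (abs_nonneg _) ?_
      rw [Finset.abs_prod]
      exact Finset.prod_le_one (fun _ _ => abs_nonneg _) fun p _ => hq1 p ω
  · intro T hT
    refine Integrable.of_bound (C := 1) ?_ (Eventually.of_forall fun ω => ?_)
    · exact (((hFm T).mono hm le_rfl).mul (measurable_const.indicator
        (T.measurableSet_biInter fun p hp =>
          hE.measurable_edge p (hS p (Finset.mem_powerset.1 hT hp))))).aestronglyMeasurable
    · rw [Real.norm_eq_abs, abs_mul]
      refine mul_le_one₀ (hFb T ω) (abs_nonneg _) ?_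
      by_cases hω : ω ∈ ⋂ p ∈ T, edgeEvent V E p <;> simp [Set.indicator, hω]

/-- A product over pairs of indices `i < j` becomes a product over all ordered pairs of points,
since `avoidProb` is `1` at distances that are not positive. -/
theorem prod_pairs_eq_prod_avoidProb (hg_symm : ∀ x, g (-x) = g x) {r : ℝ} (hr : 0 ≤ r)
    {W : Set ℝ} (hW : W.Finite) {K : ℕ} (hK : W.ncard ≤ K) :
    ∏ p ∈ (Finset.range K ×ˢ Finset.range K).filter (fun p => p.1 < p.2),
      (1 - if p.2 < W.ncard ∧ r < orderPoint W p.2 - orderPoint W p.1 then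
        g (orderPoint W p.1 - orderPoint W p.2) else 0) =
      ∏ x ∈ hW.toFinset, ∏ y ∈ hW.toFinset, avoidProb g r (y - x) := by
  rw [prod_orderPoint]
  simp_rw [prod_orderPoint]
  rw [← Finset.prod_product', Finset.prod_filter]
  symm
  have hsub : Finset.range W.ncard ×ˢ Finset.range W.ncard ⊆
      Finset.range K ×ˢ Finset.range K :=
    Finset.product_subset_product (Finset.range_mono hK) (Finset.range_mono hK)
  rw [← Finset.prod_subset hsub]
  · refine Finset.prod_congr rfl fun p hp => ?_
    rw [Finset.mem_product, Finset.mem_range, Finset.mem_range] at hp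
    simp only [avoidProb]
    by_cases h : p.1 < p.2
    · rw [if_pos h, ← hg_symm, neg_sub]
      by_cases h2 : r < orderPoint W p.2 - orderPoint W p.1 <;> simp [hp.2, h2]
    · rw [if_neg h, if_neg]
      have := orderPoint_le hW (not_lt.1 h) hp.1
      linarith
  · intro p _ hp
    rw [Finset.mem_product, Finset.mem_range, Finset.mem_range] at hp
    by_cases h : p.1 < p.2
    · rw [if_pos h, if_neg, sub_zero]
      rintro ⟨h2, -⟩
      exact hp ⟨h.trans h2, h2⟩
    · rw [if_neg h]

theorem measurable_prod_pairs (hV : ∀ ω, (V ω).Finite)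
    (hcount : ∀ A, MeasurableSet A → Measurable fun ω => (V ω ∩ A).ncard)
    (hg : Measurable g) (r : ℝ) (S : Finset (ℕ × ℕ)) :
    Measurable fun ω => ∏ p ∈ S, (1 - if p.2 < (V ω).ncard ∧
        r < orderPoint (V ω) p.2 - orderPoint (V ω) p.1 then
      g (orderPoint (V ω) p.1 - orderPoint (V ω) p.2) else 0) := by
  have hm := sigmaPoints_le hcount
  have hX : ∀ i, Measurable fun ω => orderPoint (V ω) i := fun i =>
    (measurable_sigmaPoints_orderPoint (V := V) hV i).mono hm le_rfl
  have hN : Measurable fun ω => (V ω).ncard :=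
    (measurable_sigmaPoints_ncard_univ (V := V)).mono hm le_rfl
  refine Finset.measurable_prod _ fun p _ => measurable_const.sub
    (Measurable.ite ?_ (hg.comp ((hX _).sub (hX _))) measurable_const)
  exact (measurableSet_lt measurable_const hN).inter
    (measurableSet_lt measurable_const ((hX _).sub (hX _)))

theorem measurable_prod_avoidProb (hV : ∀ ω, (V ω).Finite)
    (hcount : ∀ A, MeasurableSet A → Measurable fun ω => (V ω ∩ A).ncard)
    (hg : Measurable g) (hg_symm : ∀ x, g (-x) = g x) {r : ℝ} (hr : 0 ≤ r) :
    Measurable fun ω =>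
      ∏ x ∈ (hV ω).toFinset, ∏ y ∈ (hV ω).toFinset, avoidProb g r (y - x) := by
  refine measurable_of_tendsto_metrizable
    (fun K => measurable_prod_pairs hV hcount hg r
      ((Finset.range K ×ˢ Finset.range K).filter (fun p => p.1 < p.2)))
    (tendsto_pi_nhds.2 fun ω => tendsto_const_nhds.congr' ?_)
  filter_upwards [eventually_ge_atTop (V ω).ncard] with K hK
  exact (prod_pairs_eq_prod_avoidProb hg_symm hr (hV ω) hK).symm

/-- The probability that no edge is longer than `r`, as the expectation of its conditional
probability given the vertices. -/
theorem measureReal_longestEdge_le (hV : ∀ ω, (V ω).Finite)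
    (hcount : ∀ A, MeasurableSet A → Measurable fun ω => (V ω ∩ A).ncard)
    (hg : Measurable g) (hg_mem : ∀ x, g x ∈ Set.Icc (0 : ℝ) 1) (hg_symm : ∀ x, g (-x) = g x)
    (hE : IsSoftRandomGraph μ g V E) {r : ℝ} (hr : 0 ≤ r) :
    μ.real {ω | longestEdge (E ω) ≤ r} =
      ∫ ω, ∏ x ∈ (hV ω).toFinset, ∏ y ∈ (hV ω).toFinset, avoidProb g r (y - x) ∂μ := by
  have hm := sigmaPoints_le hcount
  have hX : ∀ i, Measurable fun ω => orderPoint (V ω) i := fun i =>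
    (measurable_sigmaPoints_orderPoint (V := V) hV i).mono hm le_rfl
  set S : ℕ → Finset (ℕ × ℕ) := fun K =>
    (Finset.range K ×ˢ Finset.range K).filter (fun p => p.1 < p.2) with hSdef
  have hS : ∀ K, ∀ p ∈ S K, p.1 < p.2 := fun K p hp => (Finset.mem_filter.1 hp).2
  set A : ℕ → Set Ω := fun K => {ω | ∀ p ∈ S K, ω ∈ edgeEvent V E p →
    orderPoint (V ω) p.2 - orderPoint (V ω) p.1 ≤ r} with hA
  have hAm : ∀ K, MeasurableSet (A K) := by
    intro K
    have : A K = ⋂ p ∈ S K,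
        (edgeEvent V E p)ᶜ ∪ {ω | orderPoint (V ω) p.2 - orderPoint (V ω) p.1 ≤ r} := by
      ext ω
      simp only [hA, Set.mem_iInter, Set.mem_union, Set.mem_compl_iff, Set.mem_ofPred_eq,
        imp_iff_not_or]
    rw [this]
    exact (S K).measurableSet_biInter fun p hp => (hE.measurable_edge p (hS K p hp)).compl.union
      (measurableSet_le ((hX _).sub (hX _)) measurable_const)
  have hAanti : Antitone A := by
    intro K L hKL ω hω p hp
    refine hω p ?_
    simp only [hSdef, Finset.mem_filter, Finset.mem_product, Finset.mem_range] at hp ⊢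
    omega
  have hinter : {ω | longestEdge (E ω) ≤ r} = ⋂ K, A K := by
    ext ω
    simp only [Set.mem_ofPred_eq, longestEdge_le_iff hV hE.edge_mem hr, Set.mem_iInter, hA]
    refine ⟨fun h K p hp => h p (hS K p hp), fun h p hp => h (p.2 + 1) p ?_⟩
    simp only [hSdef, Finset.mem_filter, Finset.mem_product, Finset.mem_range]
    omega
  have h1 : Tendsto (fun K => μ.real (A K)) atTop (𝓝 (μ.real {ω | longestEdge (E ω) ≤ r})) := by
    rw [hinter]
    exact (ENNReal.tendsto_toReal (measure_ne_top _ _)).comp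
      (tendsto_measure_iInter_atTop (fun K => (hAm K).nullMeasurableSet) hAanti
        ⟨0, measure_ne_top _ _⟩)
  refine tendsto_nhds_unique h1 ?_
  simp only [hA, measureReal_forall_edgeEvent hV hcount hg hg_mem hE r (hS _)]
  refine tendsto_integral_of_dominated_convergence (fun _ => (1 : ℝ)) ?_ (integrable_const _)
    ?_ ?_
  · intro K
    exact (measurable_prod_pairs hV hcount hg r (S K)).aestronglyMeasurable
  · intro K
    refine Eventually.of_forall fun ω => ?_
    rw [Real.norm_eq_abs, Finset.abs_prod]
    refine Finset.prod_le_one (fun _ _ => abs_nonneg _) fun p _ => ?_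
    have := hg_mem (orderPoint (V ω) p.1 - orderPoint (V ω) p.2)
    rw [abs_le]
    split_ifs <;> constructor <;> linarith [this.1, this.2]
  · refine Eventually.of_forall fun ω => tendsto_const_nhds.congr' ?_
    filter_upwards [eventually_ge_atTop (V ω).ncard] with K hK
    exact (prod_pairs_eq_prod_avoidProb hg_symm hr (hV ω) hK).symm

end Conditioning

/-! ### Moments of the Poisson distribution -/

section PoissonMoments

theorem hasSum_inv_factorial : HasSum (fun n : ℕ => ((n.factorial : ℝ))⁻¹) (Real.exp 1) := by
  simpa [Real.exp_eq_exp_ℝ] using NormedSpace.expSeries_div_hasSum_exp (1 : ℝ)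

theorem hasSum_cast_div_factorial :
    HasSum (fun n : ℕ => (n : ℝ) * ((n.factorial : ℝ))⁻¹) (Real.exp 1) := by
  rw [← hasSum_nat_add_iff' 1]
  simp only [Finset.range_one, Finset.sum_singleton, Nat.cast_zero, zero_mul, sub_zero]
  refine hasSum_inv_factorial.congr_fun ?_ 
  intro n
  rw [Nat.factorial_succ]
  push_cast
  field_simp

theorem hasSum_cast_sq_div_factorial :
    HasSum (fun n : ℕ => (n : ℝ) ^ 2 * ((n.factorial : ℝ))⁻¹) (2 * Real.exp 1) := by
  rw [← hasSum_nat_add_iff' 1]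
  simp only [Finset.range_one, Finset.sum_singleton, Nat.cast_zero, ne_eq, OfNat.ofNat_ne_zero,
    not_false_eq_true, zero_pow, zero_mul, sub_zero, two_mul]
  refine (hasSum_cast_div_factorial.add hasSum_inv_factorial).congr_fun ?_
  intro n
  rw [Nat.factorial_succ]
  push_cast
  field_simp

variable {Ω : Type*} [MeasurableSpace Ω] {μ : Measure Ω} {X : Ω → ℕ}

theorem memLp_two_of_map_eq_poissonMeasure_one (hX : Measurable X)
    (h : μ.map X = poissonMeasure 1) : MemLp (fun ω => (X ω : ℝ)) 2 μ := by
  rw [memLp_two_iff_integrable_sq (by fun_prop)]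
  have : Integrable (fun n : ℕ => (n : ℝ) ^ 2) (μ.map X) := by
    rw [h, integrable_poissonMeasure_iff]
    refine (hasSum_cast_sq_div_factorial.summable.mul_left (Real.exp (-1))).congr fun n => ?_
    simp [div_eq_mul_inv]
    ring
  exact this.comp_measurable hX

theorem integral_of_map_eq_poissonMeasure_one (hX : Measurable X)
    (h : μ.map X = poissonMeasure 1) : ∫ ω, (X ω : ℝ) ∂μ = 1 := by
  rw [← integral_map (f := fun n : ℕ => (n : ℝ)) hX.aemeasurable (by fun_prop), h,
    integral_poissonMeasure]
  have := (hasSum_cast_div_factorial.mul_left (Real.exp (-1))).tsum_eq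
  rw [← Real.exp_add] at this
  simp only [neg_add_cancel, Real.exp_zero] at this
  rw [← this]
  congr with n
  simp [div_eq_mul_inv]
  ring

theorem integral_sq_of_map_eq_poissonMeasure_one (hX : Measurable X)
    (h : μ.map X = poissonMeasure 1) : ∫ ω, (X ω : ℝ) ^ 2 ∂μ = 2 := by
  rw [← integral_map (f := fun n : ℕ => (n : ℝ) ^ 2) hX.aemeasurable (by fun_prop), h,
    integral_poissonMeasure]
  have := (hasSum_cast_sq_div_factorial.mul_left (Real.exp (-1))).tsum_eq
  rw [mul_left_comm, ← Real.exp_add] at this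
  simp only [neg_add_cancel, Real.exp_zero, mul_one] at this
  rw [← this]
  congr with n
  simp [div_eq_mul_inv]
  ring

end PoissonMoments

/-! ### Quadratic forms in independent variables -/

section QuadraticForm

variable {Ω : Type*} [MeasurableSpace Ω] {μ : Measure Ω} {ι : Type*} {N : ι → Ω → ℝ}

theorem memLp_two_mul_of_iIndepFun (hN : ∀ i, Measurable (N i)) (hind : iIndepFun N μ)
    (hL : ∀ i, MemLp (N i) 2 μ) {i j : ι} (hij : i ≠ j) : MemLp (N i * N j) 2 μ := by
  rw [memLp_two_iff_integrable_sq ((hN i).mul (hN j)).aestronglyMeasurable]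
  have h := ((hind.indepFun hij).comp (φ := fun x : ℝ => x ^ 2) (ψ := fun x : ℝ => x ^ 2)
    (by fun_prop) (by fun_prop)).integrable_mul (hL i).integrable_sq (hL j).integrable_sq
  refine h.congr (Eventually.of_forall fun ω => ?_)
  simp [mul_pow]

theorem memLp_quadratic (hN : ∀ i, Measurable (N i)) (hind : iIndepFun N μ)
    (hL : ∀ i, MemLp (N i) 2 μ) {c : ι × ι → ℝ} {p : ι × ι} (hp : p.1 ≠ p.2) :
    MemLp (fun ω => c p * (N p.1 * N p.2) ω) 2 μ :=
  (memLp_two_mul_of_iIndepFun hN hind hL hp).const_mul _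

theorem integral_mul_of_iIndepFun (hN : ∀ i, Measurable (N i)) (hind : iIndepFun N μ)
    (h1 : ∀ i, ∫ ω, N i ω ∂μ = 1) {i j : ι} (hij : i ≠ j) : ∫ ω, (N i * N j) ω ∂μ = 1 := by
  have := (hind.indepFun hij).integral_mul_eq_mul_integral (hN i).aestronglyMeasurable
    (hN j).aestronglyMeasurable
  rw [this, h1, h1, one_mul]

/-- For independent variables with first moment `1` and second moment `2`, such as Poisson variables
of mean `1`. -/
theorem variance_mul_of_iIndepFun [IsProbabilityMeasure μ] (hN : ∀ i, Measurable (N i)) (hind : iIndepFun N μ)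
    (hL : ∀ i, MemLp (N i) 2 μ) (h1 : ∀ i, ∫ ω, N i ω ∂μ = 1)
    (h2 : ∀ i, ∫ ω, N i ω ^ 2 ∂μ = 2) {i j : ι} (hij : i ≠ j) : Var[N i * N j; μ] = 3 := by
  rw [variance_eq_sub (memLp_two_mul_of_iIndepFun hN hind hL hij),
    integral_mul_of_iIndepFun hN hind h1 hij]
  have h := ((hind.indepFun hij).comp (φ := fun x : ℝ => x ^ 2) (ψ := fun x : ℝ => x ^ 2)
    (by fun_prop) (by fun_prop)).integral_mul_eq_mul_integral
    ((hN i).pow_const 2).aestronglyMeasurable ((hN j).pow_const 2).aestronglyMeasurable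
  have h' : ∫ ω, ((N i * N j) ^ 2) ω ∂μ = 2 * 2 := by
    rw [← h2 i]
    nth_rewrite 2 [h2 i]
    rw [← h2 j]
    refine Eq.trans ?_ h
    congr with ω
    simp [mul_pow]
  rw [h']
  norm_num

/-- Products over disjoint pairs of indices are uncorrelated; any two products have covariance at
most their common variance `3`. -/
theorem covariance_mul_le [IsProbabilityMeasure μ] [DecidableEq ι]
    (hN : ∀ i, Measurable (N i)) (hind : iIndepFun N μ)
    (hL : ∀ i, MemLp (N i) 2 μ) (h1 : ∀ i, ∫ ω, N i ω ∂μ = 1)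
    (h2 : ∀ i, ∫ ω, N i ω ^ 2 ∂μ = 2) {p q : ι × ι} (hp : p.1 ≠ p.2) (hq : q.1 ≠ q.2) :
    cov[N p.1 * N p.2, N q.1 * N q.2; μ] ≤
      3 * ((if q.1 = p.1 then 1 else 0) + (if q.2 = p.1 then 1 else 0) +
        (if q.1 = p.2 then 1 else 0) + (if q.2 = p.2 then 1 else 0)) := by
  have hLp := memLp_two_mul_of_iIndepFun hN hind hL hp
  have hLq := memLp_two_mul_of_iIndepFun hN hind hL hq
  by_cases hd : p.1 ≠ q.1 ∧ p.1 ≠ q.2 ∧ p.2 ≠ q.1 ∧ p.2 ≠ q.2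
  · rw [(hind.indepFun_mul_mul hN p.1 p.2 q.1 q.2 hd.1 hd.2.1 hd.2.2.1
      hd.2.2.2).covariance_eq_zero hLp hLq]
    positivity
  · have h3 : cov[N p.1 * N p.2, N q.1 * N q.2; μ] ≤ 3 := by
      have h := variance_sub hLp hLq
      rw [variance_mul_of_iIndepFun hN hind hL h1 h2 hp,
        variance_mul_of_iIndepFun hN hind hL h1 h2 hq] at h
      have := variance_nonneg (N p.1 * N p.2 - N q.1 * N q.2) μ
      linarith
    refine h3.trans ?_
    have : (1 : ℝ) ≤ (if q.1 = p.1 then 1 else 0) + (if q.2 = p.1 then 1 else 0) +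
        (if q.1 = p.2 then 1 else 0) + (if q.2 = p.2 then 1 else 0) := by
      split_ifs <;> norm_num
      grind
    linarith

/-- The function `x ↦ exp (-x)` is `1`-Lipschitz on `[0, ∞)`, and the mean absolute deviation is at
most the standard deviation. -/
theorem abs_integral_exp_neg_sub_le [IsProbabilityMeasure μ] {W : Ω → ℝ} (hW : MemLp W 2 μ) (hW0 : ∀ ω, 0 ≤ W ω) :
    |∫ ω, Real.exp (-W ω) ∂μ - Real.exp (-∫ ω, W ω ∂μ)| ≤ √Var[W; μ] := by
  set m := ∫ ω, W ω ∂μ with hm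
  have hm0 : 0 ≤ m := integral_nonneg hW0
  have hWm : MemLp (fun ω => W ω - m) 2 μ := hW.sub (memLp_const m)
  have habs : MemLp (fun ω => |W ω - m|) 2 μ := hWm.abs
  have hlip : ∀ x y : ℝ, 0 ≤ x → 0 ≤ y → |Real.exp (-x) - Real.exp (-y)| ≤ |x - y| := by
    have key : ∀ x y : ℝ, 0 ≤ x → x ≤ y → |Real.exp (-x) - Real.exp (-y)| ≤ |x - y| := by
      intro x y hx hxy
      rw [abs_of_nonneg (sub_nonneg.2 (Real.exp_le_exp.2 (neg_le_neg hxy))), abs_sub_comm,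
        abs_of_nonneg (sub_nonneg.2 hxy)]
      have h1 : Real.exp (-y) = Real.exp (-x) * Real.exp (-(y - x)) := by
        rw [← Real.exp_add]; ring_nf
      have h2 := Real.add_one_le_exp (-(y - x))
      have h3 : Real.exp (-x) ≤ 1 := Real.exp_le_one_iff.2 (by linarith)
      have h4 := Real.exp_pos (-x)
      rw [h1]
      nlinarith
    intro x y hx hy
    rcases le_total x y with h | h
    · exact key x y hx h
    · rw [abs_sub_comm, abs_sub_comm x]; exact key y x hy h
  have hexp : Integrable (fun ω => Real.exp (-W ω)) μ :=
    Integrable.of_bound (Real.continuous_exp.comp_aestronglyMeasurable hW.1.neg) 1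
      (Eventually.of_forall fun ω => by
        rw [Real.norm_eq_abs, Real.abs_exp]
        exact Real.exp_le_one_iff.2 (neg_nonpos.2 (hW0 ω)))
  calc |∫ ω, Real.exp (-W ω) ∂μ - Real.exp (-m)|
      = |∫ ω, (Real.exp (-W ω) - Real.exp (-m)) ∂μ| := by
        rw [integral_sub hexp (integrable_const _)]; simp
    _ ≤ ∫ ω, |Real.exp (-W ω) - Real.exp (-m)| ∂μ := abs_integral_le_integral_abs
    _ ≤ ∫ ω, |W ω - m| ∂μ := integral_mono (hexp.sub (integrable_const _)).abs
        (habs.integrable (by norm_num)) fun ω => hlip _ _ (hW0 ω) hm0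
    _ ≤ √Var[W; μ] := by
        refine Real.le_sqrt_of_sq_le ?_
        have h := variance_nonneg (fun ω => |W ω - m|) μ
        rw [variance_eq_sub habs] at h
        rw [variance_eq_integral hW.aemeasurable]
        have h' : ∫ ω, ((fun ω => |W ω - m|) ^ 2) ω ∂μ = ∫ ω, (W ω - m) ^ 2 ∂μ := by
          congr with ω
          simp
        linarith

variable [Fintype ι] [IsProbabilityMeasure μ]

theorem variance_quadratic_le [DecidableEq ι] (hN : ∀ i, Measurable (N i)) (hind : iIndepFun N μ)
    (hL : ∀ i, MemLp (N i) 2 μ) (h1 : ∀ i, ∫ ω, N i ω ∂μ = 1)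
    (h2 : ∀ i, ∫ ω, N i ω ^ 2 ∂μ = 2) {c : ι × ι → ℝ} (hc : ∀ p, 0 ≤ c p)
    {D : ℝ} (hrow : ∀ i, ∑ j, c (i, j) ≤ D) (hcol : ∀ j, ∑ i, c (i, j) ≤ D) :
    Var[fun ω => ∑ p ∈ Finset.univ.filter (fun p : ι × ι => p.1 ≠ p.2),
      c p * (N p.1 * N p.2) ω; μ] ≤ 12 * (∑ p, c p) * D := by
  set s := Finset.univ.filter (fun p : ι × ι => p.1 ≠ p.2) with hs
  have hs' : ∀ p ∈ s, p.1 ≠ p.2 := fun p hp => (Finset.mem_filter.1 hp).2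
  rw [variance_fun_sum' fun p hp => memLp_quadratic hN hind hL (hs' p hp)]
  have hfst : ∀ i, ∑ q ∈ s, c q * (if q.1 = i then 1 else 0) ≤ D := by
    intro i
    calc _ ≤ ∑ q, c q * (if q.1 = i then 1 else 0) :=
          Finset.sum_le_sum_of_subset_of_nonneg (Finset.filter_subset _ _) fun q _ _ =>
            mul_nonneg (hc q) (by split_ifs <;> norm_num)
      _ = ∑ j, c (i, j) := by
          rw [Fintype.sum_prod_type_right]
          simp
      _ ≤ D := hrow i
  have hsnd : ∀ i, ∑ q ∈ s, c q * (if q.2 = i then 1 else 0) ≤ D := by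
    intro i
    calc _ ≤ ∑ q, c q * (if q.2 = i then 1 else 0) :=
          Finset.sum_le_sum_of_subset_of_nonneg (Finset.filter_subset _ _) fun q _ _ =>
            mul_nonneg (hc q) (by split_ifs <;> norm_num)
      _ = ∑ j, c (j, i) := by
          rw [Fintype.sum_prod_type]
          simp
      _ ≤ D := hcol i
  calc ∑ p ∈ s, ∑ q ∈ s, cov[fun ω => c p * (N p.1 * N p.2) ω,
        fun ω => c q * (N q.1 * N q.2) ω; μ]
      ≤ ∑ p ∈ s, ∑ q ∈ s, 3 * c p * (c q * (if q.1 = p.1 then 1 else 0) +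
          c q * (if q.2 = p.1 then 1 else 0) + c q * (if q.1 = p.2 then 1 else 0) +
          c q * (if q.2 = p.2 then 1 else 0)) := by
        refine Finset.sum_le_sum fun p hp => Finset.sum_le_sum fun q hq => ?_
        rw [covariance_const_mul_left, covariance_const_mul_right]
        have := mul_le_mul_of_nonneg_left (covariance_mul_le hN hind hL h1 h2 (hs' p hp)
          (hs' q hq)) (mul_nonneg (hc p) (hc q))
        linarith
    _ = ∑ p ∈ s, 3 * c p * (∑ q ∈ s, c q * (if q.1 = p.1 then 1 else 0) +
          ∑ q ∈ s, c q * (if q.2 = p.1 then 1 else 0) +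
          ∑ q ∈ s, c q * (if q.1 = p.2 then 1 else 0) +
          ∑ q ∈ s, c q * (if q.2 = p.2 then 1 else 0)) := by
        refine Finset.sum_congr rfl fun p _ => ?_
        rw [← Finset.mul_sum]
        simp only [Finset.sum_add_distrib]
    _ ≤ ∑ p ∈ s, c p * (12 * D) := by
        refine Finset.sum_le_sum fun p _ => ?_
        have := mul_le_mul_of_nonneg_left (add_le_add (add_le_add (add_le_add
          (hfst p.1) (hsnd p.1)) (hfst p.2)) (hsnd p.2)) (mul_nonneg zero_le_three (hc p))
        linarith
    _ ≤ ∑ p, c p * (12 * D) := by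
        rcases isEmpty_or_nonempty ι with hι | ⟨⟨i⟩⟩
        · rw [Finset.eq_empty_of_isEmpty s]; simp
        have hD : 0 ≤ D := (Finset.sum_nonneg fun j _ => hc (i, j)).trans (hrow i)
        exact Finset.sum_le_sum_of_subset_of_nonneg (Finset.filter_subset _ _) fun q _ _ =>
            mul_nonneg (hc q) (by positivity)
    _ = 12 * (∑ p, c p) * D := by rw [← Finset.sum_mul]; ring

/-- The Laplace functional of a quadratic form with small row and column sums is close to that of a
constant. The hypothesis on the diagonal is needed because `N i ^ 2` need not be square integrable. -/
theorem abs_integral_exp_neg_quadratic_sub_le (hN : ∀ i, Measurable (N i))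
    (hN0 : ∀ i ω, 0 ≤ N i ω) (hind : iIndepFun N μ)
    (hL : ∀ i, MemLp (N i) 2 μ) (h1 : ∀ i, ∫ ω, N i ω ∂μ = 1)
    (h2 : ∀ i, ∫ ω, N i ω ^ 2 ∂μ = 2) {c : ι × ι → ℝ} (hc : ∀ p, 0 ≤ c p)
    (hdiag : ∀ i, c (i, i) = 0)
    {D : ℝ} (hrow : ∀ i, ∑ j, c (i, j) ≤ D) (hcol : ∀ j, ∑ i, c (i, j) ≤ D) :
    |∫ ω, Real.exp (-∑ p : ι × ι, c p * (N p.1 ω * N p.2 ω)) ∂μ - Real.exp (-∑ p, c p)| ≤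
      √(12 * (∑ p, c p) * D) := by
  classical
  set s := Finset.univ.filter (fun p : ι × ι => p.1 ≠ p.2) with hs
  have hs' : ∀ p ∈ s, p.1 ≠ p.2 := fun p hp => (Finset.mem_filter.1 hp).2
  have hzero : ∀ p ∉ s, c p = 0 := by
    rintro ⟨i, j⟩ hp
    have : i = j := by simpa [hs] using hp
    rw [this, hdiag]
  have hW : ∀ ω, ∑ p : ι × ι, c p * (N p.1 ω * N p.2 ω) =
      ∑ p ∈ s, c p * (N p.1 * N p.2) ω := by
    intro ω
    symm
    exact Finset.sum_subset (Finset.subset_univ _) fun p _ hp => by rw [hzero p hp, zero_mul]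
  have hm : ∫ ω, ∑ p ∈ s, c p * (N p.1 * N p.2) ω ∂μ = ∑ p, c p := by
    rw [integral_finsetSum _ fun p hp =>
      (memLp_quadratic hN hind hL (hs' p hp)).integrable (by norm_num)]
    rw [← Finset.sum_subset (Finset.subset_univ s) fun p _ hp => hzero p hp]
    refine Finset.sum_congr rfl fun p hp => ?_
    rw [integral_const_mul, integral_mul_of_iIndepFun hN hind h1 (hs' p hp), mul_one]
  simp_rw [hW]
  rw [← hm]
  refine (abs_integral_exp_neg_sub_le (memLp_finsetSum _ fun p hp =>
    memLp_quadratic hN hind hL (hs' p hp)) fun ω => Finset.sum_nonneg fun p _ =>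
      mul_nonneg (hc p) (mul_nonneg (hN0 _ _) (hN0 _ _))).trans ?_
  rw [hm]
  exact Real.sqrt_le_sqrt (variance_quadratic_le hN hind hL h1 h2 hc hrow hcol)

end QuadraticForm

/-! ### Products over the cells of a partition -/

section Partition

variable {α ι : Type*} [Fintype ι] {S : Finset α} {T : ι → Finset α}

/-- An exponential of a quadratic form in cell counts, as a product over pairs of points. -/
theorem exp_neg_sum_eq_prod (T : ι → Finset α) (c : ι × ι → ℝ) :
    Real.exp (-∑ p : ι × ι, c p * ((T p.1).card * (T p.2).card)) =
      ∏ a, ∏ _x ∈ T a, ∏ b, ∏ _y ∈ T b, Real.exp (-c (a, b)) := by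
  simp only [Finset.prod_const, ← Real.exp_nat_mul, ← Real.exp_sum, Fintype.sum_prod_type]
  congr 1
  rw [← Finset.sum_neg_distrib]
  refine Finset.sum_congr rfl fun a _ => ?_
  rw [← Finset.sum_neg_distrib, Finset.mul_sum]
  refine Finset.sum_congr rfl fun b _ => ?_
  ring

variable [DecidableEq α]

theorem prod_prod_eq_prod_cells (hS : S = Finset.univ.biUnion T)
    (hT : Pairwise fun a b => Disjoint (T a) (T b)) (F : α → α → ℝ) :
    ∏ x ∈ S, ∏ y ∈ S, F x y = ∏ a, ∏ x ∈ T a, ∏ b, ∏ y ∈ T b, F x y := by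
  have hd : (↑(Finset.univ : Finset ι) : Set ι).PairwiseDisjoint T := fun a _ b _ hab => hT hab
  rw [hS, Finset.prod_biUnion hd]
  simp only [Finset.prod_biUnion hd]

theorem prod_prod_le_exp (hS : S = Finset.univ.biUnion T)
    (hT : Pairwise fun a b => Disjoint (T a) (T b)) {F : α → α → ℝ} (hF : ∀ x y, 0 ≤ F x y)
    {c : ι × ι → ℝ} (h : ∀ a b, ∀ x ∈ T a, ∀ y ∈ T b, F x y ≤ Real.exp (-c (a, b))) :
    ∏ x ∈ S, ∏ y ∈ S, F x y ≤
      Real.exp (-∑ p : ι × ι, c p * ((T p.1).card * (T p.2).card)) := by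
  rw [exp_neg_sum_eq_prod T, prod_prod_eq_prod_cells hS hT]
  have h0 : ∀ x, ∀ s : Finset α, 0 ≤ ∏ y ∈ s, F x y := fun x s =>
    Finset.prod_nonneg fun y _ => hF x y
  have h00 : ∀ x, 0 ≤ ∏ b, ∏ y ∈ T b, F x y := fun x => Finset.prod_nonneg fun b _ => h0 x _
  exact Finset.prod_le_prod (fun a _ => Finset.prod_nonneg fun x _ => h00 x) fun a _ =>
    Finset.prod_le_prod (fun x _ => h00 x) fun x hx =>
    Finset.prod_le_prod (fun b _ => h0 x _) fun b _ =>
    Finset.prod_le_prod (fun y _ => hF x y) fun y hy => h a b x hx y hy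

theorem exp_le_prod_prod (hS : S = Finset.univ.biUnion T)
    (hT : Pairwise fun a b => Disjoint (T a) (T b)) {F : α → α → ℝ}
    {c : ι × ι → ℝ} (h : ∀ a b, ∀ x ∈ T a, ∀ y ∈ T b, Real.exp (-c (a, b)) ≤ F x y) :
    Real.exp (-∑ p : ι × ι, c p * ((T p.1).card * (T p.2).card)) ≤
      ∏ x ∈ S, ∏ y ∈ S, F x y := by
  rw [exp_neg_sum_eq_prod T, prod_prod_eq_prod_cells hS hT]
  have h0 : ∀ (a : ι) (b : ι), 0 ≤ ∏ _y ∈ T b, Real.exp (-c (a, b)) := fun a b =>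
    Finset.prod_nonneg fun y _ => (Real.exp_pos _).le
  have h00 : ∀ a, 0 ≤ ∏ b, ∏ _y ∈ T b, Real.exp (-c (a, b)) := fun a =>
    Finset.prod_nonneg fun b _ => h0 a b
  exact Finset.prod_le_prod (fun a _ => Finset.prod_nonneg fun x _ => h00 a) fun a _ =>
    Finset.prod_le_prod (fun x _ => h00 a) fun x hx =>
    Finset.prod_le_prod (fun b _ => h0 a b) fun b _ =>
    Finset.prod_le_prod (fun y _ => (Real.exp_pos _).le) fun y hy => h a b x hx y hy

end Partition

/-! ### Unit cells of the window -/

section Cells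

/-- The `a`-th unit cell, counted from `0`, of the subdivision of `[-n, n)`. -/
def cell (n a : ℕ) : Set ℝ := Set.Ico (-n + a : ℝ) (-n + a + 1)

theorem measurableSet_cell (n a : ℕ) : MeasurableSet (cell n a) := measurableSet_Ico

theorem isBounded_cell (n a : ℕ) : Bornology.IsBounded (cell n a) := Metric.isBounded_Ico _ _

theorem disjoint_cell (n : ℕ) {a b : ℕ} (hab : a ≠ b) : Disjoint (cell n a) (cell n b) := by
  wlog h : a < b generalizing a b
  · exact (this hab.symm (by omega)).symm
  rw [Set.disjoint_left]
  intro x hx hy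
  have : (a : ℝ) + 1 ≤ b := by exact_mod_cast h
  linarith [hx.2, hy.1]

theorem exists_mem_cell {n : ℕ} {x : ℝ} (hx : x ∈ Set.Ico (-n : ℝ) n) :
    ∃ a < 2 * n, x ∈ cell n a := by
  have h0 : 0 ≤ x + n := by linarith [hx.1]
  refine ⟨⌊x + n⌋₊, ?_, ?_, ?_⟩
  · rw [Nat.floor_lt h0]
    push_cast
    linarith [hx.2]
  · linarith [Nat.floor_le h0]
  · linarith [Nat.lt_floor_add_one (x + n)]

theorem cell_subset {n a : ℕ} (ha : a < 2 * n) : cell n a ⊆ Set.Icc (-n : ℝ) n := by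
  intro x hx
  have h1 : (a : ℝ) + 1 ≤ 2 * n := by exact_mod_cast ha
  have h0 : (0 : ℝ) ≤ a := a.cast_nonneg
  constructor <;> linarith [hx.1, hx.2]

theorem sub_mem_of_mem_cell {n a b : ℕ} {x y : ℝ} (hx : x ∈ cell n a) (hy : y ∈ cell n b) :
    y - x ∈ Set.Ioo ((b : ℝ) - a - 1) (b - a + 1) := by
  constructor <;> linarith [hx.1, hx.2, hy.1, hy.2]

variable {Ω : Type*} [MeasurableSpace Ω] {μ : Measure Ω} {P : Ω → Set ℝ}

theorem IsUnitPoissonProcess.finite_window (hP : IsUnitPoissonProcess μ P)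
    (n : ℕ) (ω : Ω) : (window P n ω).Finite :=
  hP.locally_finite ω n

theorem IsUnitPoissonProcess.measurable_ncard_window (hP : IsUnitPoissonProcess μ P)
    (n : ℕ) (A : Set ℝ) (hA : MeasurableSet A) :
    Measurable fun ω => (window P n ω ∩ A).ncard := by
  simp only [window, Set.inter_assoc]
  exact hP.measurable_count _ (measurableSet_Icc.inter hA)
    ((Metric.isBounded_Icc _ _).subset Set.inter_subset_left)

/-- In particular the right end point of the window, which the half-open cells miss, is almost surely
not a point of the process. -/
theorem IsUnitPoissonProcess.ae_notMem (hP : IsUnitPoissonProcess μ P)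
    (t : ℝ) : ∀ᵐ ω ∂μ, t ∉ P ω := by
  have hm := hP.measurable_count {t} (measurableSet_singleton t) Bornology.isBounded_singleton
  have h := hP.law_count {t} (measurableSet_singleton t) Bornology.isBounded_singleton
  have h0 : ∀ᵐ k ∂(μ.map fun ω => (P ω ∩ {t}).ncard), k = 0 := by
    rw [h, ae_iff]
    have : (poissonMeasure (volume ({t} : Set ℝ)).toNNReal) {0} = 1 := by
      rw [poissonMeasure_singleton]; simp
    exact (prob_compl_eq_zero_iff (MeasurableSet.of_discrete (s := {0}))).2 this
  filter_upwards [ae_of_ae_map hm.aemeasurable h0] with ω hω hmem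
  rw [Set.inter_eq_right.2 (Set.singleton_subset_iff.2 hmem), Set.ncard_singleton] at hω
  exact one_ne_zero hω

theorem IsUnitPoissonProcess.map_ncard_cell (hP : IsUnitPoissonProcess μ P)
    (n a : ℕ) :
    μ.map (fun ω => (P ω ∩ cell n a).ncard) = poissonMeasure 1 := by
  rw [hP.law_count _ (measurableSet_cell n a) (isBounded_cell n a)]
  congr 1
  rw [cell, Real.volume_Ico]
  simp

theorem IsUnitPoissonProcess.measurable_ncard_cell (hP : IsUnitPoissonProcess μ P)
    (n a : ℕ) :
    Measurable fun ω => (P ω ∩ cell n a).ncard :=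
  hP.measurable_count _ (measurableSet_cell n a) (isBounded_cell n a)

theorem IsUnitPoissonProcess.abs_integral_exp_cells_sub_le [IsProbabilityMeasure μ]
    (hP : IsUnitPoissonProcess μ P) (n : ℕ)
    {c : Fin (2 * n) × Fin (2 * n) → ℝ} (hc : ∀ p, 0 ≤ c p) (hdiag : ∀ i, c (i, i) = 0)
    {D : ℝ} (hrow : ∀ i, ∑ j, c (i, j) ≤ D) (hcol : ∀ j, ∑ i, c (i, j) ≤ D) :
    |∫ ω, Real.exp (-∑ p : Fin (2 * n) × Fin (2 * n), c p *
        (((P ω ∩ cell n p.1).ncard : ℝ) * ((P ω ∩ cell n p.2).ncard : ℝ))) ∂μ -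
        Real.exp (-∑ p, c p)| ≤ √(12 * (∑ p, c p) * D) := by
  have hm := fun a : Fin (2 * n) => hP.measurable_ncard_cell n a
  have hl := fun a : Fin (2 * n) => hP.map_ncard_cell n a
  have hind := hP.indep_count (2 * n) (fun a => cell n a) (fun a => measurableSet_cell n a)
    (fun a => isBounded_cell n a) (fun a b hab => disjoint_cell n (Fin.val_injective.ne hab))
  exact abs_integral_exp_neg_quadratic_sub_le
    (N := fun (a : Fin (2 * n)) ω => ((P ω ∩ cell n a).ncard : ℝ))
    (fun a => measurable_from_top.comp (hm a)) (fun _ _ => Nat.cast_nonneg _)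
    (hind.comp (fun _ k => (k : ℝ)) fun _ => measurable_from_top)
    (fun a => memLp_two_of_map_eq_poissonMeasure_one (hm a) (hl a))
    (fun a => integral_of_map_eq_poissonMeasure_one (hm a) (hl a))
    (fun a => integral_sq_of_map_eq_poissonMeasure_one (hm a) (hl a)) hc hdiag hrow hcol

theorem IsUnitPoissonProcess.window_eq_biUnion_cells (hP : IsUnitPoissonProcess μ P)
    (n : ℕ) {ω : Ω} (hω : (n : ℝ) ∉ P ω)
    {T : Fin (2 * n) → Finset ℝ} (hT : ∀ a, (T a : Set ℝ) = P ω ∩ cell n a) :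
    (hP.finite_window n ω).toFinset = Finset.univ.biUnion T := by
  have hT' : ∀ a x, x ∈ T a ↔ x ∈ P ω ∧ x ∈ cell n a := fun a x => by
    rw [← Finset.mem_coe, hT]; rfl
  ext x
  simp only [Set.Finite.mem_toFinset, window, Finset.mem_biUnion, Finset.mem_univ, true_and, hT']
  constructor
  · rintro ⟨hx, h1, h2⟩
    have hne : x ≠ n := fun h => hω (h ▸ hx)
    obtain ⟨a, ha, hxa⟩ := exists_mem_cell ⟨h1, lt_of_le_of_ne h2 hne⟩
    exact ⟨⟨a, ha⟩, hx, hxa⟩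
  · rintro ⟨a, hx, hxa⟩
    exact ⟨hx, cell_subset a.2 hxa⟩

theorem IsUnitPoissonProcess.finite_cell (hP : IsUnitPoissonProcess μ P)
    {n : ℕ} (a : Fin (2 * n)) (ω : Ω) :
    (P ω ∩ cell n a).Finite :=
  (hP.finite_window n ω).subset (Set.inter_subset_inter_right _ (cell_subset a.2))

variable {g : ℝ → ℝ} {E : Ω → Set (Sym2 ℝ)}

/-- An upper bound for `P(e_n ≤ r)` from a lower bound `c` for `-log (avoidProb g r)` on each pair of
cells. -/
theorem measureReal_longestEdge_le_exp_add [IsProbabilityMeasure μ] (hP : IsUnitPoissonProcess μ P)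
    (hg : Measurable g) (hg_mem : ∀ x, g x ∈ Set.Icc (0 : ℝ) 1) (hg_symm : ∀ x, g (-x) = g x)
    {n : ℕ} (hE : IsSoftRandomGraph μ g (window P n) E) {r : ℝ} (hr : 0 ≤ r)
    {c : Fin (2 * n) × Fin (2 * n) → ℝ} (hc : ∀ p, 0 ≤ c p) (hdiag : ∀ i, c (i, i) = 0)
    {D : ℝ} (hrow : ∀ i, ∑ j, c (i, j) ≤ D) (hcol : ∀ j, ∑ i, c (i, j) ≤ D)
    (h : ∀ a b : Fin (2 * n), ∀ x ∈ cell n a, ∀ y ∈ cell n b, avoidProb g r (y - x) ≤ Real.exp (-c (a, b))) :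
    μ.real {ω | longestEdge (E ω) ≤ r} ≤
      Real.exp (-∑ p, c p) + √(12 * (∑ p, c p) * D) := by
  have hF : ∀ τ, 0 ≤ avoidProb g r τ := by
    intro τ
    rw [avoidProb]
    split_ifs
    · linarith [(hg_mem τ).2]
    · norm_num
  rw [measureReal_longestEdge_le (hP.finite_window n) (hP.measurable_ncard_window n) hg hg_mem
    hg_symm hE hr]
  have hmain := (abs_le.1 (hP.abs_integral_exp_cells_sub_le n hc hdiag hrow hcol)).2
  refine le_trans (integral_mono_of_nonneg ?_ ?_ ?_) (sub_le_iff_le_add'.1 hmain)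
  · exact Eventually.of_forall fun ω => Finset.prod_nonneg fun x _ =>
      Finset.prod_nonneg fun y _ => hF _
  · refine Integrable.of_bound (C := 1) ?_ (Eventually.of_forall fun ω => ?_)
    · refine (Measurable.exp (Measurable.neg (Finset.measurable_sum _ fun p _ =>
        measurable_const.mul (Measurable.mul ?_ ?_)))).aestronglyMeasurable
      · exact measurable_from_top.comp (hP.measurable_ncard_cell n _)
      · exact measurable_from_top.comp (hP.measurable_ncard_cell n _)
    · rw [Real.norm_eq_abs, Real.abs_exp]
      exact Real.exp_le_one_iff.2 (neg_nonpos.2 (Finset.sum_nonneg fun p _ =>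
        mul_nonneg (hc p) (by positivity)))
  · filter_upwards [hP.ae_notMem n] with ω hω
    have hfin := fun a => hP.finite_cell (n := n) a ω
    have hmem : ∀ a x, x ∈ (hfin a).toFinset → x ∈ cell n a := fun a x hx =>
      ((hfin a).mem_toFinset.1 hx).2
    have key := prod_prod_le_exp (T := fun a => (hfin a).toFinset)
      (hP.window_eq_biUnion_cells n hω fun a => (hfin a).coe_toFinset)
      (fun a b hab => Finset.disjoint_left.2 fun x hx hy => Set.disjoint_left.1
        (disjoint_cell n (Fin.val_injective.ne hab)) (hmem a x hx) (hmem b x hy))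
      (F := fun x y => avoidProb g r (y - x)) (fun x y => hF _)
      (fun a b x hx y hy => h a b x (hmem a x hx) y (hmem b y hy))
    simpa only [Set.ncard_eq_toFinset_card _ (hfin _)] using key

/-- A lower bound for `P(e_n ≤ r)` from an upper bound `c` for `-log (avoidProb g r)` on each pair of
cells. -/
theorem exp_sub_le_measureReal_longestEdge [IsProbabilityMeasure μ] (hP : IsUnitPoissonProcess μ P)
    (hg : Measurable g) (hg_mem : ∀ x, g x ∈ Set.Icc (0 : ℝ) 1) (hg_symm : ∀ x, g (-x) = g x)
    {n : ℕ} (hE : IsSoftRandomGraph μ g (window P n) E) {r : ℝ} (hr : 0 ≤ r)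
    {c : Fin (2 * n) × Fin (2 * n) → ℝ} (hc : ∀ p, 0 ≤ c p) (hdiag : ∀ i, c (i, i) = 0)
    {D : ℝ} (hrow : ∀ i, ∑ j, c (i, j) ≤ D) (hcol : ∀ j, ∑ i, c (i, j) ≤ D)
    (h : ∀ a b : Fin (2 * n), ∀ x ∈ cell n a, ∀ y ∈ cell n b, Real.exp (-c (a, b)) ≤ avoidProb g r (y - x)) :
    Real.exp (-∑ p, c p) - √(12 * (∑ p, c p) * D) ≤
      μ.real {ω | longestEdge (E ω) ≤ r} := by
  have hF : ∀ τ, |avoidProb g r τ| ≤ 1 := by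
    intro τ
    rw [avoidProb, abs_le]
    split_ifs
    · constructor <;> linarith [(hg_mem τ).1, (hg_mem τ).2]
    · norm_num
  rw [measureReal_longestEdge_le (hP.finite_window n) (hP.measurable_ncard_window n) hg hg_mem
    hg_symm hE hr]
  have hmain := (abs_le.1 (hP.abs_integral_exp_cells_sub_le n hc hdiag hrow hcol)).1
  refine le_trans (by linarith) (integral_mono_of_nonneg (Eventually.of_forall fun ω =>
    (Real.exp_pos _).le) ?_ ?_)
  · refine Integrable.of_bound (C := 1) ?_ (Eventually.of_forall fun ω => ?_)
    · exact (measurable_prod_avoidProb (hP.finite_window n) (hP.measurable_ncard_window n) hg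
        hg_symm hr).aestronglyMeasurable
    · rw [Real.norm_eq_abs, Finset.abs_prod]
      refine Finset.prod_le_one (fun _ _ => abs_nonneg _) fun x _ => ?_
      rw [Finset.abs_prod]
      exact Finset.prod_le_one (fun _ _ => abs_nonneg _) fun y _ => hF _
  · filter_upwards [hP.ae_notMem n] with ω hω
    have hfin := fun a => hP.finite_cell (n := n) a ω
    have hmem : ∀ a x, x ∈ (hfin a).toFinset → x ∈ cell n a := fun a x hx =>
      ((hfin a).mem_toFinset.1 hx).2
    have key := exp_le_prod_prod (T := fun a => (hfin a).toFinset)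
      (hP.window_eq_biUnion_cells n hω fun a => (hfin a).coe_toFinset)
      (fun a b hab => Finset.disjoint_left.2 fun x hx hy => Set.disjoint_left.1
        (disjoint_cell n (Fin.val_injective.ne hab)) (hmem a x hx) (hmem b x hy))
      (F := fun x y => avoidProb g r (y - x))
      (fun a b x hx y hy => h a b x (hmem a x hx) y (hmem b y hy))
    simpa only [Set.ncard_eq_toFinset_card _ (hfin _)] using key

end Cells

/-! ### Sums over pairs of cells -/

section ToeplitzSums

variable {k : ℝ → ℝ} {M : ℕ}

theorem sum_range_sub_eq (hk : ∀ t ≤ 0, k t = 0) {i : ℕ} (hi : i ≤ M) :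
    ∑ j ∈ Finset.range M, k ((j : ℝ) - i) = ∑ d ∈ Finset.range (M - i), k d := by
  rw [← Finset.sum_range_add_sum_Ico _ hi, Finset.sum_eq_zero, zero_add,
    Finset.sum_Ico_eq_sum_range]
  · refine Finset.sum_congr rfl fun d _ => ?_
    push_cast
    rw [add_sub_cancel_left]
  · intro j hj
    have : (j : ℝ) ≤ i := by exact_mod_cast (Finset.mem_range.1 hj).le
    exact hk _ (by linarith)

theorem sum_row_le (hk : ∀ t ≤ 0, k t = 0) (hk0 : ∀ t, 0 ≤ k t) (i : Fin M) :
    ∑ j : Fin M, k ((j : ℝ) - i) ≤ ∑ d ∈ Finset.range M, k d := by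
  rw [Fin.sum_univ_eq_sum_range (fun j => k ((j : ℝ) - i)), sum_range_sub_eq hk i.2.le]
  exact Finset.sum_le_sum_of_subset_of_nonneg (Finset.range_mono (Nat.sub_le _ _))
    fun _ _ _ => hk0 _

theorem sum_col_le (hk : ∀ t ≤ 0, k t = 0) (hk0 : ∀ t, 0 ≤ k t) (j : Fin M) :
    ∑ i : Fin M, k ((j : ℝ) - i) ≤ ∑ d ∈ Finset.range M, k d := by
  have hj : (j : ℕ) + 1 ≤ M := j.2
  rw [Fin.sum_univ_eq_sum_range (fun i => k ((j : ℝ) - i)),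
    ← Finset.sum_range_add_sum_Ico _ hj, Finset.sum_eq_zero (s := Finset.Ico _ _), add_zero,
    ← Finset.sum_range_reflect]
  · refine (Finset.sum_le_sum_of_subset_of_nonneg (Finset.range_mono hj)
      fun _ _ _ => hk0 _).trans_eq' ?_
    refine Finset.sum_congr rfl fun d hd => ?_
    have : d ≤ j := Nat.lt_succ_iff.1 (Finset.mem_range.1 hd)
    rw [Nat.add_sub_cancel, Nat.cast_sub this, sub_sub_cancel]
  · intro i hi
    have : ((j : ℕ) : ℝ) ≤ i := by
      exact_mod_cast (Nat.le_succ _).trans (Finset.mem_Ico.1 hi).1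
    exact hk _ (by linarith)

/-- Among the pairs of indices below `M`, exactly `M - d` have difference `d`. -/
theorem sum_pairs_eq (hk : ∀ t ≤ 0, k t = 0) :
    ∑ p : Fin M × Fin M, k ((p.2 : ℝ) - p.1) = ∑ d ∈ Finset.range M, ((M : ℝ) - d) * k d := by
  rw [Fintype.sum_prod_type]
  simp only
  calc ∑ i : Fin M, ∑ j : Fin M, k ((j : ℝ) - i)
      = ∑ i ∈ Finset.range M, ∑ d ∈ Finset.range (M - i), k d := by
        rw [← Fin.sum_univ_eq_sum_range (fun i => ∑ d ∈ Finset.range (M - i), k d)]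
        refine Finset.sum_congr rfl fun i _ => ?_
        rw [Fin.sum_univ_eq_sum_range (fun j => k ((j : ℝ) - i)), sum_range_sub_eq hk i.2.le]
    _ = ∑ d ∈ Finset.range M, ∑ i ∈ Finset.range (M - d), k d := by
        refine Finset.sum_comm' fun i d => ?_
        simp only [Finset.mem_range]
        omega
    _ = _ := by
        refine Finset.sum_congr rfl fun d hd => ?_
        rw [Finset.sum_const, Finset.card_range, nsmul_eq_mul,
          Nat.cast_sub (Finset.mem_range.1 hd).le]

end ToeplitzSums

/-! ### Kernels on cells and their sums -/

section KernelBounds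

/-- `cellUpper α r ε (b - a)` bounds from above the contribution `-log (1 - g)` of a pair of points
in the unit cells number `a` and `b` whose distance exceeds `r`, provided that `r` is large. -/
noncomputable def cellUpper (α r ε t : ℝ) : ℝ := if r - 1 < t then (1 + ε) * (t - 1) ^ (-α) else 0

/-- `cellLower α r ε (b - a)` bounds from below the contribution `-log (1 - g)` of a pair of points
in the unit cells number `a` and `b` whose distance exceeds `r`, provided that `r` is large; it
vanishes when not all pairs of points in these cells are guaranteed such a distance. -/
noncomputable def cellLower (α r ε t : ℝ) : ℝ := if r + 1 ≤ t then (1 - ε) * (t + 1) ^ (-α) else 0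

variable {α r ε : ℝ}

theorem cellUpper_nonneg (hr : 6 ≤ r) (hε : ε ∈ Set.Ioo (0 : ℝ) 1) (t : ℝ) :
    0 ≤ cellUpper α r ε t := by
  rw [cellUpper]
  split_ifs with h
  · exact mul_nonneg (by linarith [hε.1]) (Real.rpow_nonneg (by linarith) _)
  · exact le_rfl

theorem cellLower_nonneg (hr : 6 ≤ r) (hε : ε ∈ Set.Ioo (0 : ℝ) 1) (t : ℝ) :
    0 ≤ cellLower α r ε t := by
  rw [cellLower]
  split_ifs with h
  · exact mul_nonneg (by linarith [hε.2]) (Real.rpow_nonneg (by linarith) _)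
  · exact le_rfl

theorem cellUpper_of_nonpos (hr : 6 ≤ r) {t : ℝ} (ht : t ≤ 0) : cellUpper α r ε t = 0 :=
  if_neg (by linarith)

theorem cellLower_of_nonpos (hr : 6 ≤ r) {t : ℝ} (ht : t ≤ 0) : cellLower α r ε t = 0 :=
  if_neg (by linarith)

theorem rpow_neg_anti (hα : 0 < α) {x y : ℝ} (hx : 0 < x) (hxy : x ≤ y) :
    y ^ (-α) ≤ x ^ (-α) :=
  Real.rpow_le_rpow_of_nonpos hx hxy (by linarith)

theorem cellLower_le_cellUpper (hα : 0 < α) (hr : 6 ≤ r) (hε : ε ∈ Set.Ioo (0 : ℝ) 1) (t : ℝ) :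
    cellLower α r ε t ≤ cellUpper α r ε t := by
  by_cases h : r + 1 ≤ t
  · rw [cellLower, cellUpper, if_pos h, if_pos (by linarith)]
    exact mul_le_mul (by linarith [hε.1]) (rpow_neg_anti hα (by linarith) (by linarith))
      (Real.rpow_nonneg (by linarith) _) (by linarith [hε.1])
  · rw [cellLower, if_neg h]
    exact cellUpper_nonneg hr hε t

theorem antitoneOn_mul_rpow_neg (hα : 0 < α) (M : ℝ) :
    AntitoneOn (fun t : ℝ => (M - t) * t ^ (-α)) (Set.Ioc 0 M) := by
  intro x hx y hy hxy
  exact mul_le_mul (by linarith) (rpow_neg_anti hα hx.1 hxy)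
    (Real.rpow_nonneg hy.1.le _) (by linarith [hx.2])

theorem intervalIntegrable_mul_rpow_neg (M : ℝ) {a b : ℝ} (ha : 0 < a) (hb : 0 < b) :
    IntervalIntegrable (fun t : ℝ => (M - t) * t ^ (-α)) volume a b := by
  refine ContinuousOn.intervalIntegrable fun t ht => ?_
  have ht0 : 0 < t := lt_of_lt_of_le (lt_min ha hb) ht.1
  exact ((continuousAt_const.sub continuousAt_id).mul
    (Real.continuousAt_rpow_const _ _ (Or.inl ht0.ne'))).continuousWithinAt

theorem integral_mul_rpow_neg_nonneg {M a b : ℝ} (ha : 0 < a) (hab : a ≤ b) (hb : b ≤ M) :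
    0 ≤ ∫ t in a..b, (M - t) * t ^ (-α) :=
  intervalIntegral.integral_nonneg hab fun t ht =>
    mul_nonneg (by linarith [ht.2]) (Real.rpow_nonneg (by linarith [ht.1]) _)

theorem integral_mul_rpow_neg_le (hα : 0 < α) {M a b : ℝ} (ha : 0 < a) (hab : a ≤ b)
    (hb : b ≤ M) :
    ∫ t in a..b, (M - t) * t ^ (-α) ≤ (b - a) * ((M - a) * a ^ (-α)) := by
  calc _ ≤ ∫ _ in a..b, (M - a) * a ^ (-α) := by
        refine intervalIntegral.integral_mono_on hab
          (intervalIntegrable_mul_rpow_neg M ha (ha.trans_le hab)) (by simp) fun t ht => ?_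
        exact antitoneOn_mul_rpow_neg hα M ⟨ha, hab.trans hb⟩
          ⟨ha.trans_le ht.1, ht.2.trans hb⟩ ht.1
    _ = _ := by rw [intervalIntegral.integral_const, smul_eq_mul]

/-- Moving `r` by at most `3` changes `r ^ (-α)` by at most a constant factor. -/
theorem rpow_neg_sub_three_le (hα : 0 < α) (hr : 6 ≤ r) {s : ℝ} (hs : r - 3 ≤ s) :
    s ^ (-α) ≤ 2 ^ α * r ^ (-α) := by
  calc s ^ (-α) ≤ (r / 2) ^ (-α) := rpow_neg_anti hα (by linarith) (by linarith)
    _ = _ := by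
      rw [Real.div_rpow (by linarith) zero_le_two, Real.rpow_neg zero_le_two α, div_inv_eq_mul,
        mul_comm]

theorem sum_cellUpper_le (hα : 0 < α) (hr : 6 ≤ r) {M : ℕ} (hrM : r ≤ M)
    (hε : ε ∈ Set.Ioo (0 : ℝ) 1) :
    ∑ d ∈ Finset.range M, cellUpper α r ε d ≤ (1 + ε) * (2 ^ α * ((M - r + 3) * r ^ (-α))) := by
  set d₀ := ⌊r - 1⌋₊ + 1 with hd₀
  have hd₀r : r - 1 < d₀ := by
    rw [hd₀]; push_cast; exact Nat.lt_floor_add_one _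
  have hcast : ∀ d : ℕ, r - 1 < d ↔ d₀ ≤ d := fun d => by
    rw [← Nat.floor_lt (by linarith), hd₀, Nat.succ_le_iff]
  have hpos : 0 ≤ (2 : ℝ) ^ α * r ^ (-α) := by
    have : 0 ≤ r := by linarith
    positivity
  calc ∑ d ∈ Finset.range M, cellUpper α r ε d
      ≤ ∑ d ∈ Finset.range M, if d₀ ≤ d then (1 + ε) * (2 ^ α * r ^ (-α)) else 0 := by
        refine Finset.sum_le_sum fun d _ => ?_
        rw [cellUpper]
        by_cases h : d₀ ≤ d
        · rw [if_pos h, if_pos ((hcast d).2 h)]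
          have h' := (hcast d).2 h
          exact mul_le_mul_of_nonneg_left (rpow_neg_sub_three_le hα hr (by linarith))
            (by linarith [hε.1])
        · rw [if_neg h, if_neg (mt (hcast d).1 h)]
    _ = ((Finset.range M).filter (d₀ ≤ ·)).card * ((1 + ε) * (2 ^ α * r ^ (-α))) := by
        rw [← Finset.sum_filter, Finset.sum_const, nsmul_eq_mul]
    _ ≤ (M - r + 3) * ((1 + ε) * (2 ^ α * r ^ (-α))) := by
        refine mul_le_mul_of_nonneg_right ?_ (mul_nonneg (by linarith [hε.1]) hpos)
        have hc : (Finset.range M).filter (d₀ ≤ ·) = Finset.Ico d₀ M := by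
          ext d; simp [and_comm]
        rw [hc, Nat.card_Ico]
        rcases le_total d₀ M with h | h
        · rw [Nat.cast_sub h]; linarith
        · rw [Nat.sub_eq_zero_of_le h]; push_cast; linarith
    _ = _ := by ring

theorem sum_mul_cellUpper_le (hα : 0 < α) (hr : 6 ≤ r) {M : ℕ} (hrM : r ≤ M)
    (hε : ε ∈ Set.Ioo (0 : ℝ) 1) :
    ∑ d ∈ Finset.range M, ((M : ℝ) - d) * cellUpper α r ε d ≤
      (1 + ε) * ((∫ t in r..M, ((M : ℝ) - t) * t ^ (-α)) +
        3 * (2 ^ α * ((M - r + 3) * r ^ (-α)))) := by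
  set d₀ := ⌊r - 1⌋₊ - 1 with hd₀
  have hfl : 1 ≤ ⌊r - 1⌋₊ := Nat.le_floor (by push_cast; linarith)
  have hd₀' : (d₀ : ℝ) = ⌊r - 1⌋₊ - 1 := by rw [hd₀, Nat.cast_sub hfl]; simp
  have hd₀r : r - 3 < d₀ := by
    rw [hd₀']; linarith [Nat.lt_floor_add_one (r - 1)]
  have hd₀r' : (d₀ : ℝ) ≤ r := by
    rw [hd₀']; linarith [Nat.floor_le (a := r - 1) (by linarith)]
  have hcast : ∀ d : ℕ, r - 1 < d ↔ d₀ + 2 ≤ d := fun d => by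
    rw [← Nat.floor_lt (by linarith), hd₀]; omega
  have h1 : ∑ d ∈ Finset.range M, ((M : ℝ) - d) * cellUpper α r ε d ≤
      (1 + ε) * ∑ i ∈ Finset.Ico d₀ M, if i + 2 < M then
        ((M : ℝ) - (i + 1 : ℕ)) * ((i + 1 : ℕ) : ℝ) ^ (-α) else 0 := by
    have hsub : ∑ d ∈ Finset.range M, ((M : ℝ) - d) * cellUpper α r ε d =
        ∑ d ∈ Finset.Ico (d₀ + 2) M, ((M : ℝ) - d) * cellUpper α r ε d := by
      symm
      refine Finset.sum_subset (fun d hd => Finset.mem_range.2 (Finset.mem_Ico.1 hd).2)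
        fun d hd hd' => ?_
      have : ¬ d₀ + 2 ≤ d := fun h => hd' (Finset.mem_Ico.2 ⟨h, Finset.mem_range.1 hd⟩)
      rw [cellUpper, if_neg (mt (hcast d).1 this), mul_zero]
    rw [hsub, Finset.mul_sum]
    calc _ = ∑ i ∈ Finset.Ico d₀ (M - 2), ((M : ℝ) - (i + 2 : ℕ)) *
            cellUpper α r ε (i + 2 : ℕ) := by
          rw [Finset.sum_Ico_add' (fun d : ℕ => ((M : ℝ) - d) * cellUpper α r ε d)]
          rcases le_or_gt 2 M with h | h
          · rw [Nat.sub_add_cancel h]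
          · rw [Finset.Ico_eq_empty (by omega), Finset.Ico_eq_empty (by omega)]
      _ ≤ ∑ i ∈ Finset.Ico d₀ (M - 2), (1 + ε) * (((M : ℝ) - (i + 1 : ℕ)) *
            ((i + 1 : ℕ) : ℝ) ^ (-α)) := by
          refine Finset.sum_le_sum fun i hi => ?_
          rw [Finset.mem_Ico] at hi
          have hi2 : ((i + 2 : ℕ) : ℝ) ≤ M := by exact_mod_cast (by omega : i + 2 ≤ M)
          rw [cellUpper, if_pos ((hcast _).2 (by omega))]
          have e : ((i + 2 : ℕ) : ℝ) - 1 = (i + 1 : ℕ) := by push_cast; ring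
          rw [e, mul_left_comm]
          refine mul_le_mul_of_nonneg_left (mul_le_mul_of_nonneg_right ?_
            (Real.rpow_nonneg (Nat.cast_nonneg _) _)) (by linarith [hε.1])
          push_cast; linarith
      _ ≤ _ := by
          have : Finset.Ico d₀ (M - 2) = (Finset.Ico d₀ M).filter (fun i => i + 2 < M) := by
            ext i; simp only [Finset.mem_Ico, Finset.mem_filter]; omega
          rw [this, Finset.sum_filter]
          refine Finset.sum_le_sum fun i _ => ?_
          split_ifs <;> simp
  have hd₀M : d₀ ≤ M := by exact_mod_cast hd₀r'.trans hrM
  have hd₀pos : (0 : ℝ) < d₀ := by linarith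
  have h2 : ∑ i ∈ Finset.Ico d₀ M, (if i + 2 < M then
        ((M : ℝ) - (i + 1 : ℕ)) * ((i + 1 : ℕ) : ℝ) ^ (-α) else 0) ≤
      ∫ t in (d₀ : ℝ)..M, ((M : ℝ) - t) * t ^ (-α) := by
    refine le_trans (Finset.sum_le_sum fun i hi => ?_)
      (AntitoneOn.sum_le_integral_Ico (f := fun t : ℝ => ((M : ℝ) - t) * t ^ (-α)) hd₀M
        ((antitoneOn_mul_rpow_neg hα M).mono fun t ht => ⟨hd₀pos.trans_le ht.1, ht.2⟩))
    split_ifs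
    · exact le_rfl
    · have : ((i + 1 : ℕ) : ℝ) ≤ M := by exact_mod_cast (Finset.mem_Ico.1 hi).2
      exact mul_nonneg (by linarith) (Real.rpow_nonneg (Nat.cast_nonneg _) _)
  have h3 : ∫ t in (d₀ : ℝ)..M, ((M : ℝ) - t) * t ^ (-α) ≤
      (∫ t in r..M, ((M : ℝ) - t) * t ^ (-α)) + 3 * (2 ^ α * ((M - r + 3) * r ^ (-α))) := by
    rw [← intervalIntegral.integral_add_adjacent_intervals (b := r)
      (intervalIntegrable_mul_rpow_neg _ hd₀pos (by linarith))
      (intervalIntegrable_mul_rpow_neg _ (by linarith) (by linarith)), add_comm]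
    refine add_le_add le_rfl ((integral_mul_rpow_neg_le hα hd₀pos hd₀r' hrM).trans ?_)
    have h4 := rpow_neg_sub_three_le hα hr hd₀r.le
    have h5 : 0 ≤ (d₀ : ℝ) ^ (-α) := Real.rpow_nonneg hd₀pos.le _
    calc (r - d₀) * (((M : ℝ) - d₀) * (d₀ : ℝ) ^ (-α))
        ≤ 3 * ((M - r + 3) * (2 ^ α * r ^ (-α))) := by
          refine mul_le_mul (by linarith) (mul_le_mul (by linarith) h4 h5 (by linarith))
            (mul_nonneg (by linarith) h5) (by norm_num)
      _ = _ := by ring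
  exact h1.trans (mul_le_mul_of_nonneg_left (h2.trans h3) (by linarith [hε.1]))

theorem le_sum_mul_cellLower (hα : 0 < α) (hr : 6 ≤ r) {M : ℕ} (hrM : r ≤ M)
    (hε : ε ∈ Set.Ioo (0 : ℝ) 1) :
    (1 - ε) * ((∫ t in r..M, ((M : ℝ) - t) * t ^ (-α)) -
        3 * (2 ^ α * ((M - r + 3) * r ^ (-α)))) ≤
      ∑ d ∈ Finset.range M, ((M : ℝ) - d) * cellLower α r ε d := by
  have hrpos : 0 < r := by linarith
  have hφ : (M - r) * r ^ (-α) ≤ 2 ^ α * ((M - r + 3) * r ^ (-α)) := by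
    have h5 : 0 ≤ r ^ (-α) := Real.rpow_nonneg hrpos.le _
    have h4 := rpow_neg_sub_three_le hα hr (s := r) (by linarith)
    calc (M - r) * r ^ (-α) ≤ (M - r + 3) * (2 ^ α * r ^ (-α)) :=
          mul_le_mul (by linarith) h4 h5 (by linarith)
      _ = _ := by ring
  have hφ0 : 0 ≤ (M - r) * r ^ (-α) :=
    mul_nonneg (by linarith) (Real.rpow_nonneg hrpos.le _)
  have hnn : ∀ d ∈ Finset.range M, 0 ≤ ((M : ℝ) - d) * cellLower α r ε d := fun d hd => by
    have : (d : ℝ) ≤ M := by exact_mod_cast (Finset.mem_range.1 hd).le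
    exact mul_nonneg (by linarith) (cellLower_nonneg hr hε _)
  set d₀ := ⌈r + 1⌉₊ with hd₀
  have hd₀r : r + 1 ≤ d₀ := Nat.le_ceil _
  have hd₀r' : (d₀ : ℝ) < r + 2 := by
    linarith [Nat.ceil_lt_add_one (a := r + 1) (by linarith)]
  rcases le_or_gt (d₀ + 1) M with hM | hM
  · have hMr : ((d₀ + 1 : ℕ) : ℝ) ≤ M := by exact_mod_cast hM
    have hcast : ((d₀ + 1 : ℕ) : ℝ) = d₀ + 1 := by push_cast; ring
    have h1 : (∫ t in r..M, ((M : ℝ) - t) * t ^ (-α)) - 3 * ((M - r) * r ^ (-α)) ≤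
        ∫ t in ((d₀ + 1 : ℕ) : ℝ)..M, ((M : ℝ) - t) * t ^ (-α) := by
      rw [← intervalIntegral.integral_add_adjacent_intervals (b := ((d₀ + 1 : ℕ) : ℝ))
        (intervalIntegrable_mul_rpow_neg _ hrpos (by linarith))
        (intervalIntegrable_mul_rpow_neg _ (by linarith) (by linarith))]
      have := integral_mul_rpow_neg_le hα hrpos (b := ((d₀ + 1 : ℕ) : ℝ)) (by linarith) hMr
      have h' : (((d₀ + 1 : ℕ) : ℝ) - r) * (((M : ℝ) - r) * r ^ (-α)) ≤
          3 * ((M - r) * r ^ (-α)) :=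
        mul_le_mul_of_nonneg_right (by linarith) hφ0
      linarith
    have h2 := AntitoneOn.integral_le_sum_Ico (f := fun t : ℝ => ((M : ℝ) - t) * t ^ (-α)) hM
        ((antitoneOn_mul_rpow_neg hα M).mono fun t ht => ⟨by linarith [ht.1], ht.2⟩)
    have h3 : (1 - ε) * ∑ x ∈ Finset.Ico (d₀ + 1) M, ((M : ℝ) - x) * (x : ℝ) ^ (-α) ≤
        ∑ d ∈ Finset.range M, ((M : ℝ) - d) * cellLower α r ε d := by
      have e : Finset.Ico (d₀ + 1) M = Finset.Ico (d₀ + 1) (M - 1 + 1) := by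
        rw [Nat.sub_add_cancel (by omega)]
      rw [e, ← Finset.sum_Ico_add' (fun x : ℕ => ((M : ℝ) - x) * (x : ℝ) ^ (-α)), Finset.mul_sum]
      refine le_trans (Finset.sum_le_sum fun d hd => ?_)
        (Finset.sum_le_sum_of_subset_of_nonneg (s := Finset.Ico d₀ (M - 1)) ?_
          fun d hd _ => hnn d hd)
      · rw [Finset.mem_Ico] at hd
        have hdr : r + 1 ≤ d := hd₀r.trans (by exact_mod_cast hd.1)
        rw [cellLower, if_pos hdr, mul_left_comm]
        push_cast
        refine mul_le_mul_of_nonneg_right (by linarith) (mul_nonneg (by linarith [hε.2])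
          (Real.rpow_nonneg (by linarith) _))
      · intro d hd
        rw [Finset.mem_Ico] at hd
        rw [Finset.mem_range]; omega
    refine le_trans (mul_le_mul_of_nonneg_left ?_ (by linarith [hε.2])) h3
    linarith
  · refine le_trans ?_ (Finset.sum_nonneg hnn)
    have hMr : (M : ℝ) < d₀ + 1 := by exact_mod_cast hM
    have h1 := integral_mul_rpow_neg_le hα hrpos hrM le_rfl
    have h2 : ((M : ℝ) - r) * (((M : ℝ) - r) * r ^ (-α)) ≤ 3 * ((M - r) * r ^ (-α)) :=
      mul_le_mul_of_nonneg_right (by linarith) hφ0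
    exact mul_nonpos_of_nonneg_of_nonpos (by linarith [hε.2]) (by linarith)

end KernelBounds

/-! ### Comparison of the connection function with a power -/

section Comparison

variable {g : ℝ → ℝ} {α r ε : ℝ}

theorem tendsto_div_rpow_neg_atTop
    (hg_lim : Tendsto (fun x : ℝ => g x / |x| ^ (-α)) (comap (fun x : ℝ => |x|) atTop) (𝓝 1)) :
    Tendsto (fun x : ℝ => g x / x ^ (-α)) atTop (𝓝 1) := by
  have h : Tendsto (fun x : ℝ => x) atTop (comap (fun x : ℝ => |x|) atTop) :=
    tendsto_comap_iff.2 tendsto_abs_atTop_atTop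
  refine (hg_lim.comp h).congr' ?_
  filter_upwards [eventually_ge_atTop 0] with x hx
  simp [abs_of_nonneg hx]

/-- Since `g` tends to `0` at infinity, `-log (1 - g τ)` is asymptotic to `g τ`, hence to
`τ ^ (-α)`. -/
theorem eventually_one_sub_mem (hα : 0 < α)
    (hlim : Tendsto (fun x : ℝ => g x / x ^ (-α)) atTop (𝓝 1)) (hε : 0 < ε) :
    ∀ᶠ τ in atTop, 1 - g τ ∈ Set.Icc (Real.exp (-((1 + ε) * τ ^ (-α))))
      (Real.exp (-((1 - ε) * τ ^ (-α)))) := by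
  have hz : Tendsto (fun x : ℝ => x ^ (-α)) atTop (𝓝 0) := tendsto_rpow_neg_atTop hα
  have hg0 : Tendsto g atTop (𝓝 0) := by
    have := hlim.mul hz
    rw [one_mul] at this
    refine this.congr' ?_
    filter_upwards [eventually_gt_atTop 0] with x hx
    exact div_mul_cancel₀ _ (Real.rpow_pos_of_pos hx _).ne'
  have hlim' : Tendsto (fun x : ℝ => g x / x ^ (-α) / (1 - g x)) atTop (𝓝 1) := by
    have h : Tendsto (fun x : ℝ => g x / x ^ (-α) / (1 - g x)) atTop (𝓝 (1 / (1 - 0))) :=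
      hlim.div (hg0.const_sub 1) (by norm_num)
    simpa using h
  filter_upwards [hlim.eventually_const_lt (u := 1 - ε) (by linarith),
    hlim'.eventually_lt_const (u := 1 + ε) (by linarith),
    hg0.eventually_lt_const zero_lt_one, eventually_gt_atTop 0] with τ h1 h2 h3 hτ
  have hp := Real.rpow_pos_of_pos hτ (-α)
  rw [lt_div_iff₀ hp] at h1
  have hpos : 0 < 1 - g τ := by linarith
  constructor
  · rw [div_right_comm, div_lt_iff₀ hp] at h2
    have h4 := Real.add_one_le_exp (g τ / (1 - g τ))
    have h5 : g τ / (1 - g τ) + 1 = (1 - g τ)⁻¹ := by field_simp; ring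
    rw [h5] at h4
    rw [Real.exp_neg]
    exact inv_le_of_inv_le₀ hpos (h4.trans (Real.exp_le_exp.2 h2.le))
  · have := Real.one_sub_le_exp_neg (g τ)
    exact this.trans (Real.exp_le_exp.2 (by linarith))

theorem exp_neg_cellUpper_le_avoidProb (hα : 0 < α) (hr : 6 ≤ r) (hε : ε ∈ Set.Ioo (0 : ℝ) 1)
    (hg : ∀ τ, r < τ → Real.exp (-((1 + ε) * τ ^ (-α))) ≤ 1 - g τ)
    {t τ : ℝ} (hτ : τ ∈ Set.Ioo (t - 1) (t + 1)) :
    Real.exp (-cellUpper α r ε t) ≤ avoidProb g r τ := by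
  rw [avoidProb]
  split_ifs with h
  · refine le_trans (Real.exp_le_exp.2 (neg_le_neg ?_)) (hg τ h)
    rw [cellUpper, if_pos (by linarith [hτ.2])]
    exact mul_le_mul_of_nonneg_left (rpow_neg_anti hα (by linarith [hτ.2]) hτ.1.le)
      (by linarith [hε.1])
  · exact Real.exp_le_one_iff.2 (neg_nonpos.2 (cellUpper_nonneg hr hε t))

theorem avoidProb_le_exp_neg_cellLower (hα : 0 < α) (hr : 6 ≤ r) (hε : ε ∈ Set.Ioo (0 : ℝ) 1)
    (hg_mem : ∀ x, g x ∈ Set.Icc (0 : ℝ) 1)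
    (hg : ∀ τ, r < τ → 1 - g τ ≤ Real.exp (-((1 - ε) * τ ^ (-α))))
    {t τ : ℝ} (hτ : τ ∈ Set.Ioo (t - 1) (t + 1)) :
    avoidProb g r τ ≤ Real.exp (-cellLower α r ε t) := by
  rw [cellLower]
  split_ifs with h
  · have hrτ : r < τ := by linarith [hτ.1]
    rw [avoidProb, if_pos hrτ]
    refine (hg τ hrτ).trans (Real.exp_le_exp.2 (neg_le_neg ?_))
    exact mul_le_mul_of_nonneg_left (rpow_neg_anti hα (by linarith) hτ.2.le)
      (by linarith [hε.2])
  · rw [neg_zero, Real.exp_zero, avoidProb]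
    split_ifs
    · linarith [(hg_mem τ).1]
    · exact le_rfl

end Comparison

/-! ### The Poisson limit -/

section Limit

variable {Ω : Type*} [MeasurableSpace Ω] {μ : Measure Ω} [IsProbabilityMeasure μ] {P : Ω → Set ℝ}
  {g : ℝ → ℝ} {α : ℝ}

/-- The two-sided bound for fixed `n`: `I` is the leading term of the expected number of edges longer
than `r`, and `δ` controls both the error made by passing to cells and the degrees. -/
theorem measureReal_longestEdge_le_mem_Icc (hP : IsUnitPoissonProcess μ P)
    (hg : Measurable g) (hg_mem : ∀ x, g x ∈ Set.Icc (0 : ℝ) 1) (hg_symm : ∀ x, g (-x) = g x)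
    (hα : 0 < α) {n : ℕ} {E : Ω → Set (Sym2 ℝ)} (hE : IsSoftRandomGraph μ g (window P n) E)
    {r ε : ℝ} (hr : 6 ≤ r) (hrn : r ≤ 2 * n) (hε : ε ∈ Set.Ioo (0 : ℝ) 1)
    (hgr : ∀ τ, r < τ → 1 - g τ ∈ Set.Icc (Real.exp (-((1 + ε) * τ ^ (-α))))
      (Real.exp (-((1 - ε) * τ ^ (-α))))) {I δ : ℝ}
    (hI : I = ∫ t in r..2 * n, (2 * n - t) * t ^ (-α))
    (hδ : δ = 2 ^ α * ((2 * n - r + 3) * r ^ (-α))) :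
    μ.real {ω | longestEdge (E ω) ≤ r} ∈
      Set.Icc (Real.exp (-((1 + ε) * (I + 3 * δ))) - √(48 * (I + 3 * δ) * δ))
        (Real.exp (-((1 - ε) * (I - 3 * δ))) + √(48 * (I + 3 * δ) * δ)) := by
  have hr0 : 0 ≤ r := by linarith
  have hM : ((2 * n : ℕ) : ℝ) = 2 * n := by push_cast; ring
  have hrM : r ≤ (2 * n : ℕ) := by rw [hM]; exact hrn
  have hU0 := cellUpper_nonneg (α := α) hr hε
  have hL0 := cellLower_nonneg (α := α) hr hε
  have hUz := fun t => cellUpper_of_nonpos (α := α) (ε := ε) hr (t := t)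
  have hLz := fun t => cellLower_of_nonpos (α := α) (ε := ε) hr (t := t)
  have hrow := sum_cellUpper_le hα hr hrM hε
  have hupp := sum_mul_cellUpper_le hα hr hrM hε
  have hlow := le_sum_mul_cellLower hα hr hrM hε
  rw [← sum_pairs_eq hUz] at hupp
  rw [← sum_pairs_eq hLz] at hlow
  simp only [hM] at hrow hupp hlow
  rw [← hδ] at hrow hupp hlow
  rw [← hI] at hupp hlow
  have hLU : ∀ t, cellLower α r ε t ≤ cellUpper α r ε t := cellLower_le_cellUpper hα hr hε
  have hLsum : ∑ p : Fin (2 * n) × Fin (2 * n), cellLower α r ε ((p.2 : ℝ) - p.1) ≤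
      ∑ p : Fin (2 * n) × Fin (2 * n), cellUpper α r ε ((p.2 : ℝ) - p.1) :=
    Finset.sum_le_sum fun p _ => hLU _
  have hLrow : ∑ d ∈ Finset.range (2 * n), cellLower α r ε d ≤ (1 + ε) * δ :=
    (Finset.sum_le_sum fun d _ => hLU _).trans hrow
  have hδ0 : 0 ≤ δ := by
    rw [hδ]
    have : 0 ≤ 2 * n - r + 3 := by linarith
    positivity
  have hI0 : 0 ≤ I := hI ▸ integral_mul_rpow_neg_nonneg (by linarith) hrn le_rfl
  have hsqrt : ∀ m : ℝ, m ≤ (1 + ε) * (I + 3 * δ) →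
      √(12 * m * ((1 + ε) * δ)) ≤ √(48 * (I + 3 * δ) * δ) := by
    intro m hm
    refine Real.sqrt_le_sqrt ?_
    calc 12 * m * ((1 + ε) * δ) ≤ 12 * (2 * (I + 3 * δ)) * (2 * δ) := by
          refine mul_le_mul (mul_le_mul_of_nonneg_left (hm.trans ?_) (by norm_num))
            (mul_le_mul_of_nonneg_right (by linarith [hε.2]) hδ0)
            (mul_nonneg (by linarith [hε.1]) hδ0) (by positivity)
          exact mul_le_mul_of_nonneg_right (by linarith [hε.2]) (by positivity)
      _ = _ := by ring
  constructor
  · have h := exp_sub_le_measureReal_longestEdge hP hg hg_mem hg_symm hE hr0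
      (c := fun p => cellUpper α r ε ((p.2 : ℝ) - p.1)) (fun p => hU0 _)
      (fun i => hUz _ (by simp)) (D := (1 + ε) * δ)
      (fun i => (sum_row_le hUz hU0 i).trans hrow) (fun j => (sum_col_le hUz hU0 j).trans hrow)
      (fun a b x hx y hy => exp_neg_cellUpper_le_avoidProb hα hr hε (fun τ hτ => (hgr τ hτ).1)
        (sub_mem_of_mem_cell hx hy))
    refine le_trans (sub_le_sub (Real.exp_le_exp.2 (neg_le_neg hupp)) (hsqrt _ hupp)) h
  · have h := measureReal_longestEdge_le_exp_add hP hg hg_mem hg_symm hE hr0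
      (c := fun p => cellLower α r ε ((p.2 : ℝ) - p.1)) (fun p => hL0 _)
      (fun i => hLz _ (by simp)) (D := (1 + ε) * δ)
      (fun i => (sum_row_le hLz hL0 i).trans hLrow) (fun j => (sum_col_le hLz hL0 j).trans hLrow)
      (fun a b x hx y hy => avoidProb_le_exp_neg_cellLower hα hr hε hg_mem
        (fun τ hτ => (hgr τ hτ).2) (sub_mem_of_mem_cell hx hy))
    exact h.trans (add_le_add (Real.exp_le_exp.2 (neg_le_neg hlow))
      (hsqrt _ (hLsum.trans hupp)))

/-- The thresholds `r n` are chosen such that the expected number of edges longer than `r n` in the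
window `[-n, n]`, to leading order the integral below, tends to `l`, while the order of magnitude
`(2 * n - r n) * r n ^ (-α)` of the expected number of such edges at a single vertex tends to `0`. -/
structure IsCriticalScale (α : ℝ) (r : ℕ → ℝ) (l : ℝ) : Prop where
  tendsto_atTop : Tendsto r atTop atTop
  eventually_le : ∀ᶠ n : ℕ in atTop, r n ≤ 2 * n
  tendsto_degree : Tendsto (fun n : ℕ => (2 * n - r n) * r n ^ (-α)) atTop (𝓝 0)
  tendsto_mean : Tendsto (fun n : ℕ => ∫ t in r n..2 * n, (2 * n - t) * t ^ (-α)) atTop (𝓝 l)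

/-- The Poisson limit: along a critical scale, the number of edges longer than `r n` vanishes with
the probability `exp (-l)` of a Poisson variable of mean `l`. -/
theorem tendsto_measureReal_longestEdge_le (hP : IsUnitPoissonProcess μ P)
    (hg : Measurable g) (hg_mem : ∀ x, g x ∈ Set.Icc (0 : ℝ) 1) (hg_symm : ∀ x, g (-x) = g x)
    (hα : 0 < α) (hlim : Tendsto (fun x : ℝ => g x / x ^ (-α)) atTop (𝓝 1))
    {E : ℕ → Ω → Set (Sym2 ℝ)} (hE : ∀ n, IsSoftRandomGraph μ g (window P n) (E n))
    {r : ℕ → ℝ} {l : ℝ} (hscale : IsCriticalScale α r l) :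
    Tendsto (fun n => μ.real {ω | longestEdge (E n ω) ≤ r n}) atTop (𝓝 (Real.exp (-l))) := by
  obtain ⟨hr, hrn, hδ, hI⟩ := hscale
  set I : ℕ → ℝ := fun n => ∫ t in r n..2 * n, (2 * n - t) * t ^ (-α) with hIdef
  set δ : ℕ → ℝ := fun n => 2 ^ α * ((2 * n - r n + 3) * r n ^ (-α)) with hδdef
  have hδ0 : Tendsto δ atTop (𝓝 0) := by
    have h := (hδ.add (((tendsto_rpow_neg_atTop hα).comp hr).const_mul 3)).const_mul (2 ^ α)
    simp only [mul_zero, add_zero] at h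
    refine h.congr fun n => ?_
    simp only [hδdef, Function.comp]
    ring
  have hS : Tendsto (fun n => √(48 * (I n + 3 * δ n) * δ n)) atTop (𝓝 0) := by
    have h := (((hI.add (hδ0.const_mul 3)).const_mul 48).mul hδ0).sqrt
    simpa using h
  have hlo : ∀ ε : ℝ, Tendsto (fun n => Real.exp (-((1 + ε) * (I n + 3 * δ n))) -
      √(48 * (I n + 3 * δ n) * δ n)) atTop (𝓝 (Real.exp (-((1 + ε) * l)))) := by
    intro ε
    have h := ((Real.continuous_exp.tendsto _).comp
      (((hI.add (hδ0.const_mul 3)).const_mul (1 + ε)).neg)).sub hS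
    simpa using h
  have hup : ∀ ε : ℝ, Tendsto (fun n => Real.exp (-((1 - ε) * (I n - 3 * δ n))) +
      √(48 * (I n + 3 * δ n) * δ n)) atTop (𝓝 (Real.exp (-((1 - ε) * l)))) := by
    intro ε
    have h := ((Real.continuous_exp.tendsto _).comp
      (((hI.sub (hδ0.const_mul 3)).const_mul (1 - ε)).neg)).add hS
    simpa using h
  have hmem : ∀ ε ∈ Set.Ioo (0 : ℝ) 1, ∀ᶠ n in atTop, μ.real {ω | longestEdge (E n ω) ≤ r n} ∈
      Set.Icc (Real.exp (-((1 + ε) * (I n + 3 * δ n))) - √(48 * (I n + 3 * δ n) * δ n))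
        (Real.exp (-((1 - ε) * (I n - 3 * δ n))) + √(48 * (I n + 3 * δ n) * δ n)) := by
    intro ε hε
    obtain ⟨R, hR⟩ := eventually_atTop.1 (eventually_one_sub_mem hα hlim hε.1)
    filter_upwards [hrn, hr.eventually_ge_atTop R, hr.eventually_ge_atTop 6] with n h1 h2 h3
    exact measureReal_longestEdge_le_mem_Icc hP hg hg_mem hg_symm hα (hE n) h3 h1 hε
      (fun τ hτ => hR τ (h2.trans hτ.le)) rfl rfl
  have hsmall : ∀ᶠ ε in 𝓝[>] (0 : ℝ), ε ∈ Set.Ioo (0 : ℝ) 1 :=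
    Ioo_mem_nhdsGT one_pos
  rw [tendsto_order]
  constructor
  · intro a ha
    have hc : Tendsto (fun ε : ℝ => Real.exp (-((1 + ε) * l))) (𝓝[>] 0)
        (𝓝 (Real.exp (-l))) := by
      have : Continuous fun ε : ℝ => Real.exp (-((1 + ε) * l)) := by fun_prop
      simpa using (this.tendsto 0).mono_left nhdsWithin_le_nhds
    obtain ⟨ε, hε, hε'⟩ := (hsmall.and (hc.eventually_const_lt ha)).exists
    filter_upwards [hmem ε hε, (hlo ε).eventually_const_lt hε'] with n h1 h2
    exact h2.trans_le h1.1
  · intro a ha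
    have hc : Tendsto (fun ε : ℝ => Real.exp (-((1 - ε) * l))) (𝓝[>] 0)
        (𝓝 (Real.exp (-l))) := by
      have : Continuous fun ε : ℝ => Real.exp (-((1 - ε) * l)) := by fun_prop
      simpa using (this.tendsto 0).mono_left nhdsWithin_le_nhds
    obtain ⟨ε, hε, hε'⟩ := (hsmall.and (hc.eventually_lt_const ha)).exists
    filter_upwards [hmem ε hε, (hup ε).eventually_lt_const hε'] with n h1 h2
    exact h1.2.trans_lt h2

theorem tendstoInDistribution_of_isCriticalScale {Ω' : Type*} [MeasurableSpace Ω'] {ν : Measure Ω'}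
    [IsProbabilityMeasure ν] (hP : IsUnitPoissonProcess μ P)
    (hg : Measurable g) (hg_mem : ∀ x, g x ∈ Set.Icc (0 : ℝ) 1) (hg_symm : ∀ x, g (-x) = g x)
    (hα : 0 < α) (hlim : Tendsto (fun x : ℝ => g x / x ^ (-α)) atTop (𝓝 1))
    {E : ℕ → Ω → Set (Sym2 ℝ)} (hE : ∀ n, IsSoftRandomGraph μ g (window P n) (E n))
    {U : Ω' → ℝ} (hU : pdf.IsUniform U (Set.Ioo (0 : ℝ) 1) ν volume)
    {φ : ℕ → ℝ → ℝ} (hφ : ∀ n, Measurable (φ n))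
    (h : ∀ u ∈ Set.Ioo (0 : ℝ) 1, ∃ r : ℕ → ℝ, IsCriticalScale α r (-Real.log u) ∧
      ∀ᶠ n : ℕ in atTop, ∀ x : ℝ, 0 < x → x ≤ 2 * n → (φ n x ≤ u ↔ x ≤ r n)) :
    TendstoInDistribution (fun n ω => φ n (longestEdge (E n ω))) atTop U (fun _ => μ) ν := by
  refine tendstoInDistribution_uniform_of_monotone_transform
    (fun n => measurable_longestEdge (hP.finite_window n) (hP.measurable_ncard_window n) (hE n))
    (b := fun n => 2 * n)
    (fun n ω => longestEdge_le_of_subset_Icc (hE n).edge_mem n.cast_nonneg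
      Set.inter_subset_right) hφ hU fun u hu => ?_
  obtain ⟨r, hr, hiff⟩ := h u hu
  refine ⟨r, ?_, hr.tendsto_atTop.eventually_ge_atTop 0, hiff⟩
  have := tendsto_measureReal_longestEdge_le hP hg hg_mem hg_symm hα hlim hE hr
  rwa [neg_neg, Real.exp_log hu.1] at this

end Limit

/-! ### Thresholds for exponents below two -/

theorem tendsto_two_mul_natCast_atTop : Tendsto (fun n : ℕ => (2 * n : ℝ)) atTop atTop :=
  tendsto_natCast_atTop_atTop.const_mul_atTop two_pos

section NearMaximal

variable {α : ℝ}

/-- For `α < 2` the relevant distances are asymptotic to `2 * n`, so that the integral is close to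
`(2 * n) ^ (-α) * (2 * n - r n) ^ 2 / 2`. -/
theorem isCriticalScale_of_tendsto_div (hα : 0 < α) (hα2 : α < 2) {r : ℕ → ℝ} {κ : ℝ}
    (hle : ∀ᶠ n : ℕ in atTop, r n ≤ 2 * n)
    (h : Tendsto (fun n : ℕ => (2 * n - r n) / (2 * n : ℝ) ^ (α / 2)) atTop (𝓝 κ)) :
    IsCriticalScale α r (κ ^ 2 / 2) := by
  have hM := tendsto_two_mul_natCast_atTop
  have hMpos : ∀ᶠ n : ℕ in atTop, (0 : ℝ) < 2 * n := hM.eventually_gt_atTop 0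
  have hratio : Tendsto (fun n : ℕ => r n / (2 * n)) atTop (𝓝 1) := by
    have h1 : Tendsto (fun n : ℕ => (2 * n : ℝ) ^ (-(1 - α / 2))) atTop (𝓝 0) :=
      (tendsto_rpow_neg_atTop (by linarith)).comp hM
    have h2 := (h.mul h1).const_sub 1
    rw [mul_zero, sub_zero] at h2
    refine h2.congr' ?_
    filter_upwards [hMpos] with n hn
    rw [neg_sub, Real.rpow_sub hn, Real.rpow_one]
    have hp := (Real.rpow_pos_of_pos hn (α / 2)).ne'
    rw [div_mul_div_cancel₀ hp, sub_div, div_self hn.ne', sub_sub_cancel]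
  have hrpow : Tendsto (fun n : ℕ => (r n / (2 * n)) ^ (-α)) atTop (𝓝 1) := by
    have := hratio.rpow_const (p := -α) (Or.inl one_ne_zero)
    rwa [Real.one_rpow] at this
  have hrtop : Tendsto r atTop atTop := by
    refine (hratio.pos_mul_atTop one_pos hM).congr' ?_
    filter_upwards [hMpos] with n hn
    exact div_mul_cancel₀ _ hn.ne'
  have hrα : ∀ᶠ n : ℕ in atTop,
      r n ^ (-α) = (r n / (2 * n)) ^ (-α) * ((2 * n : ℝ) ^ (α / 2))⁻¹ ^ 2 := by
    filter_upwards [hMpos, hrtop.eventually_gt_atTop 0] with n hn hr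
    rw [Real.div_rpow hr.le hn.le, ← Real.rpow_neg hn.le, ← Real.rpow_natCast,
      ← Real.rpow_mul hn.le]
    have := (Real.rpow_pos_of_pos hn (-α)).ne'
    push_cast
    rw [show -(α / 2) * 2 = -α by ring]
    field_simp
  refine ⟨hrtop, hle, ?_, ?_⟩
  · have h1 : Tendsto (fun n : ℕ => ((2 * n : ℝ) ^ (α / 2))⁻¹) atTop (𝓝 0) :=
      tendsto_inv_atTop_zero.comp ((tendsto_rpow_atTop (by linarith)).comp hM)
    have h2 := (h.mul h1).mul hrpow
    rw [mul_zero, zero_mul] at h2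
    refine h2.congr' ?_
    filter_upwards [hrα] with n hn
    rw [hn]
    ring
  · have hsq : Tendsto (fun n : ℕ => ((2 * n - r n) / (2 * n : ℝ) ^ (α / 2)) ^ 2 / 2) atTop
        (𝓝 (κ ^ 2 / 2)) := (h.pow 2).div_const 2
    have hsq' := hsq.mul hrpow
    rw [mul_one] at hsq'
    have hlin : ∀ a b : ℝ, ∫ t in a..b, (b - t) = (b - a) ^ 2 / 2 := by
      intro a b
      rw [intervalIntegral.integral_sub (by simp) (by simp), intervalIntegral.integral_const,
        integral_id, smul_eq_mul]
      ring
    refine tendsto_of_tendsto_of_tendsto_of_le_of_le' hsq hsq' ?_ ?_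
    · filter_upwards [hMpos, hrtop.eventually_gt_atTop 0, hle] with n hn hr hrn
      have e : ((2 * n - r n) / (2 * n : ℝ) ^ (α / 2)) ^ 2 / 2 =
          ∫ t in r n..2 * n, (2 * n - t) * (2 * n : ℝ) ^ (-α) := by
        rw [intervalIntegral.integral_mul_const, hlin, Real.rpow_neg hn.le,
          show α = α / 2 * (2 : ℕ) by push_cast; ring, Real.rpow_mul hn.le, Real.rpow_natCast]
        simp only [Nat.cast_ofNat]
        rw [show α / 2 * 2 / 2 = α / 2 by ring]
        ring
      rw [e]
      refine intervalIntegral.integral_mono_on hrn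
        (Continuous.intervalIntegrable (by fun_prop) _ _)
        (intervalIntegrable_mul_rpow_neg _ hr hn) fun t ht => ?_
      exact mul_le_mul_of_nonneg_left (rpow_neg_anti hα (hr.trans_le ht.1) ht.2)
        (by linarith [ht.2])
    · filter_upwards [hrtop.eventually_gt_atTop 0, hle, hrα] with n hr hrn hn
      have e : ((2 * n - r n) / (2 * n : ℝ) ^ (α / 2)) ^ 2 / 2 * (r n / (2 * n)) ^ (-α) =
          ∫ t in r n..2 * n, (2 * n - t) * r n ^ (-α) := by
        rw [intervalIntegral.integral_mul_const, hlin, hn]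
        ring
      rw [e]
      refine intervalIntegral.integral_mono_on hrn
        (intervalIntegrable_mul_rpow_neg _ hr (hr.trans_le hrn))
        (Continuous.intervalIntegrable (by fun_prop) _ _) fun t ht => ?_
      exact mul_le_mul_of_nonneg_left (rpow_neg_anti hα hr ht.1) (by linarith [ht.2])

/-- The thresholds for `α < 2` are all of the form `2 * n * ψ (κ / (2 * n) ^ (1 - α / 2))`, and only
the first-order expansion `ψ z = 1 - z + o(z)` at `0` matters. -/
theorem isCriticalScale_of_hasDerivAt (hα : 0 < α) (hα2 : α < 2) {ψ : ℝ → ℝ}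
    (hψ : HasDerivAt ψ (-1) 0) (hψ0 : ψ 0 = 1) {κ : ℝ} (hκ : 0 < κ) :
    IsCriticalScale α (fun n => 2 * n * ψ (κ / (2 * n : ℝ) ^ (1 - α / 2))) (κ ^ 2 / 2) := by
  have hM := tendsto_two_mul_natCast_atTop
  have hw : Tendsto (fun n : ℕ => (2 * n : ℝ) ^ (1 - α / 2)) atTop atTop :=
    (tendsto_rpow_atTop (by linarith)).comp hM
  have hlim : Tendsto (fun n : ℕ => (2 * n - 2 * n * ψ (κ / (2 * n : ℝ) ^ (1 - α / 2))) /
      (2 * n : ℝ) ^ (α / 2)) atTop (𝓝 κ) := by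
    have h := ((hψ.hasFDerivAt.lim_real κ).comp hw).neg
    simp only [ContinuousLinearMap.toSpanSingleton_apply, smul_eq_mul, mul_neg, mul_one, neg_neg,
      zero_add, hψ0] at h
    refine h.congr' ?_
    filter_upwards [hM.eventually_gt_atTop 0] with n hn
    simp only [Function.comp]
    rw [inv_mul_eq_div]
    have h1 : (2 * n : ℝ) / (2 * n : ℝ) ^ (α / 2) = (2 * n : ℝ) ^ (1 - α / 2) := by
      rw [Real.rpow_sub hn, Real.rpow_one]
    rw [← h1]
    ring
  refine isCriticalScale_of_tendsto_div hα hα2 ?_ hlim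
  filter_upwards [hlim.eventually_const_lt hκ, hM.eventually_gt_atTop 0] with n h1 h2
  have := (div_pos_iff_of_pos_right (Real.rpow_pos_of_pos h2 (α / 2))).1 h1
  linarith

theorem hasDerivAt_one_sub_mul_rpow_inv {q : ℝ} (hq : 0 < q) :
    HasDerivAt (fun z : ℝ => (1 - q * z) ^ q⁻¹) (-1) 0 := by
  have h1 : HasDerivAt (fun z : ℝ => 1 - q * z) (-q) 0 := by
    simpa using ((hasDerivAt_id (0 : ℝ)).const_mul q).const_sub 1
  have h2 := h1.rpow_const (p := q⁻¹) (Or.inl (by simp))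
  convert h2 using 1
  simp [hq.ne']

theorem hasDerivAt_exp_neg_zero : HasDerivAt (fun z : ℝ => Real.exp (-z)) (-1) 0 := by
  simpa using (hasDerivAt_neg (0 : ℝ)).exp

theorem exp_neg_le_iff {u : ℝ} (hu : 0 < u) (a : ℝ) : Real.exp (-a) ≤ u ↔ -Real.log u ≤ a := by
  rw [← Real.le_log_iff_exp_le hu]
  constructor <;> intro <;> linarith

/-- The sublevel sets of the transforms for `1 < α < 2`, where `q = 2 - α`, and for `α < 1`, where
`q = 1 - α`. In both cases `w = M ^ (1 - α / 2)`. -/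
theorem exp_rpow_transform_le_iff {u : ℝ} (hu : u ∈ Set.Ioo (0 : ℝ) 1) {q A M w x : ℝ}
    (hq : 0 < q) (hM : 0 < M) (hw : 0 < w) (hA : A * (M ^ q) ^ 2 = w ^ 2)
    (hsmall : 0 ≤ 1 - q * (√(2 * -Real.log u) / w)) (hx : 0 < x) (hxM : x ≤ M) :
    Real.exp (-(A * 2⁻¹ * (q ^ 2)⁻¹ * (x ^ q - M ^ q) ^ 2)) ≤ u ↔
      x ≤ M * (1 - q * (√(2 * -Real.log u) / w)) ^ q⁻¹ := by
  have hL : 0 ≤ -Real.log u := neg_nonneg.2 (Real.log_nonpos hu.1.le hu.2.le)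
  set κ := √(2 * -Real.log u) with hκ
  have hκ0 : 0 ≤ κ := Real.sqrt_nonneg _
  have hκ2 : -Real.log u = κ ^ 2 / 2 := by
    rw [hκ, Real.sq_sqrt (by linarith)]; ring
  set y := x / M with hy
  have hy0 : 0 < y := div_pos hx hM
  have hy1 : y ≤ 1 := (div_le_one hM).2 hxM
  have hxy : x = M * y := by rw [hy]; field_simp
  have hyq : y ^ q ≤ 1 := Real.rpow_le_one hy0.le hy1 hq.le
  rw [exp_neg_le_iff hu.1, hκ2, hxy, mul_le_mul_iff_right₀ hM,
    Real.le_rpow_inv_iff_of_pos hy0.le hsmall hq, Real.mul_rpow hM.le hy0.le]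
  have e : A * 2⁻¹ * (q ^ 2)⁻¹ * (M ^ q * y ^ q - M ^ q) ^ 2 =
      (w * (1 - y ^ q) / q) ^ 2 / 2 := by
    have : A * 2⁻¹ * (q ^ 2)⁻¹ * (M ^ q * y ^ q - M ^ q) ^ 2 =
      (A * (M ^ q) ^ 2) * (1 - y ^ q) ^ 2 / q ^ 2 / 2 := by
      field_simp
      ring
    rw [this, hA]
    ring
  rw [e, div_le_div_iff_of_pos_right two_pos, sq_le_sq₀ hκ0
    (div_nonneg (mul_nonneg hw.le (by linarith)) hq.le), le_div_iff₀ hq]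
  have e2 : q * (κ / w) = κ * q / w := by ring
  rw [e2, le_sub_comm, div_le_iff₀ hw, mul_comm w]

/-- The sublevel sets of the transform for `α = 1`. -/
theorem exp_log_transform_le_iff {u : ℝ} (hu : u ∈ Set.Ioo (0 : ℝ) 1) {M w x : ℝ}
    (hM : 0 < M) (hw : 0 < w) (hMw : M = w ^ 2) (hx : 0 < x) (hxM : x ≤ M) :
    Real.exp (-(M / 2 * (Real.log (x / M)) ^ 2)) ≤ u ↔
      x ≤ M * Real.exp (-(√(2 * -Real.log u) / w)) := by
  have hL : 0 ≤ -Real.log u := neg_nonneg.2 (Real.log_nonpos hu.1.le hu.2.le)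
  set κ := √(2 * -Real.log u) with hκ
  have hκ0 : 0 ≤ κ := Real.sqrt_nonneg _
  have hκ2 : -Real.log u = κ ^ 2 / 2 := by
    rw [hκ, Real.sq_sqrt (by linarith)]; ring
  have hy0 : 0 < x / M := div_pos hx hM
  have hlog : Real.log (x / M) ≤ 0 := Real.log_nonpos hy0.le ((div_le_one hM).2 hxM)
  rw [exp_neg_le_iff hu.1, hκ2, ← div_le_iff₀' hM, ← Real.log_le_iff_le_exp hy0]
  have e : M / 2 * (Real.log (x / M)) ^ 2 = (w * -Real.log (x / M)) ^ 2 / 2 := by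
    rw [hMw]; ring
  rw [e, div_le_div_iff_of_pos_right two_pos, sq_le_sq₀ hκ0
    (mul_nonneg hw.le (by linarith)), ← div_le_iff₀' hw, le_neg]

end NearMaximal

/-! ### The threshold for exponent two -/

section Proportional

theorem h_pos {x : ℝ} (hx : 0 < x) : 0 < h x := by
  rw [h]; positivity

theorem log_h {x : ℝ} (hx : 0 < x) : Real.log (h x) = Real.log (x / 2) + (2 - x) / x := by
  rw [h, Real.log_mul (by positivity) (Real.exp_pos _).ne', Real.log_exp]

theorem strictAntiOn_h : StrictAntiOn h (Set.Ioc 0 2) := by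
  have hd : ∀ x : ℝ, 0 < x → HasDerivAt (fun x : ℝ => Real.log x + 2 * x⁻¹) (x⁻¹ - 2 / x ^ 2) x := by
    intro x hx
    exact ((Real.hasDerivAt_log hx.ne').add ((hasDerivAt_inv hx.ne').const_mul 2)).congr_deriv
      (by ring)
  have key : StrictAntiOn (fun x : ℝ => Real.log x + 2 * x⁻¹) (Set.Ioc 0 2) := by
    refine strictAntiOn_of_deriv_neg (convex_Ioc 0 2)
      (fun x hx => (hd x hx.1).continuousAt.continuousWithinAt) fun x hx => ?_
    rw [interior_Ioc] at hx
    rw [(hd x hx.1).deriv]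
    have hx0 := hx.1
    have : x⁻¹ - 2 / x ^ 2 = (x - 2) / x ^ 2 := by field_simp
    rw [this]
    exact div_neg_of_neg_of_pos (by linarith [hx.2]) (by positivity)
  intro x hx y hy hxy
  rw [← Real.log_lt_log_iff (h_pos hy.1) (h_pos hx.1), log_h hx.1, log_h hy.1,
    Real.log_div hx.1.ne' two_ne_zero, Real.log_div hy.1.ne' two_ne_zero, sub_div, sub_div,
    div_self hx.1.ne', div_self hy.1.ne']
  rw [div_eq_mul_inv 2 x, div_eq_mul_inv 2 y]
  have : Real.log y + 2 * y⁻¹ < Real.log x + 2 * x⁻¹ := key hx hy hxy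
  linarith

theorem continuousOn_h : ContinuousOn h (Set.Ioi 0) := by
  unfold h
  intro x hx
  have : x ≠ 0 := ne_of_gt hx
  fun_prop (disch := assumption)

theorem exists_h_eq {v : ℝ} (hv : 1 < v) : ∃ x ∈ Set.Ioo (0 : ℝ) 2, h x = v := by
  have hL : 0 < Real.log v := Real.log_pos hv
  set w := 1 + √(Real.log v) with hw
  have hw1 : 1 < w := by
    have := Real.sqrt_pos.2 hL
    linarith
  have hw0 : 0 < w := by linarith
  set x₀ := 2 / w ^ 2 with hx₀
  have hx₀pos : 0 < x₀ := by positivity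
  have hx₀2 : x₀ < 2 := by
    rw [hx₀, div_lt_iff₀ (by positivity)]
    nlinarith
  -- with `x₀ / 2 = w⁻²`, `log (h x₀) = w² - 1 - 2 log w ≥ (w - 1)² = log v`
  have hge : v ≤ h x₀ := by
    rw [← Real.log_le_log_iff (by linarith) (h_pos hx₀pos), log_h hx₀pos]
    have e1 : Real.log (x₀ / 2) = -(2 * Real.log w) := by
      rw [hx₀, div_right_comm, div_self two_ne_zero, one_div, Real.log_inv, Real.log_pow]
      push_cast; ring
    have e2 : (2 - x₀) / x₀ = w ^ 2 - 1 := by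
      rw [hx₀]; field_simp
    have e3 : Real.log v = (w - 1) ^ 2 := by
      rw [hw, add_sub_cancel_left, Real.sq_sqrt hL.le]
    rw [e1, e2, e3]
    linarith [Real.log_le_sub_one_of_pos hw0]
  have h2 : h 2 = 1 := by simp [h]
  obtain ⟨x, hx, hxv⟩ := intermediate_value_Icc' hx₀2.le
    (continuousOn_h.mono fun y hy => hx₀pos.trans_le hy.1) ⟨h2.le.trans hv.le, hge⟩
  refine ⟨x, ⟨hx₀pos.trans_le hx.1, lt_of_le_of_ne hx.2 ?_⟩, hxv⟩
  rintro rfl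
  linarith

/-- For `α = 2` the integral over `[x * n, 2 * n]` does not depend on `n` and equals `log (h x)`. -/
theorem isCriticalScale_two {x : ℝ} (hx : x ∈ Set.Ioo (0 : ℝ) 2) :
    IsCriticalScale 2 (fun n => x * n) (Real.log (h x)) := by
  have hn := tendsto_natCast_atTop_atTop (R := ℝ)
  have hx0 := hx.1
  refine ⟨hn.const_mul_atTop hx.1, Eventually.of_forall fun n =>
    mul_le_mul_of_nonneg_right hx.2.le n.cast_nonneg, ?_, ?_⟩
  · have h1 := (tendsto_inv_atTop_zero.comp hn).const_mul ((2 - x) * (x ^ 2)⁻¹)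
    rw [mul_zero] at h1
    refine h1.congr' ?_
    filter_upwards [hn.eventually_gt_atTop 0] with n hn0
    simp only [Function.comp]
    rw [Real.rpow_neg (by positivity), show (2 : ℝ) = (2 : ℕ) by norm_num, Real.rpow_natCast]
    push_cast
    field_simp
  · refine tendsto_const_nhds.congr' ?_
    filter_upwards [hn.eventually_gt_atTop 0] with n hn0
    have hle : x * n ≤ 2 * n := mul_le_mul_of_nonneg_right hx.2.le hn0.le
    have hxn : 0 < x * n := by positivity
    have hd : ∀ t ∈ Set.uIcc (x * n) (2 * n),
        HasDerivAt (fun t : ℝ => -(2 * n) * t⁻¹ - Real.log t) ((2 * n - t) * t ^ (-2 : ℝ)) t := by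
      intro t ht
      rw [Set.uIcc_of_le hle] at ht
      have ht0 : 0 < t := hxn.trans_le ht.1
      have h1 := ((hasDerivAt_inv ht0.ne').const_mul (-(2 * n : ℝ))).sub
        (Real.hasDerivAt_log ht0.ne')
      refine h1.congr_deriv ?_
      rw [Real.rpow_neg ht0.le, show (2 : ℝ) = (2 : ℕ) by norm_num, Real.rpow_natCast]
      push_cast
      field_simp
    rw [intervalIntegral.integral_eq_sub_of_hasDerivAt hd
      (intervalIntegrable_mul_rpow_neg _ hxn (by positivity)), log_h hx0,
      Real.log_mul two_ne_zero hn0.ne', Real.log_mul hx0.ne' hn0.ne',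
      Real.log_div hx0.ne' two_ne_zero]
    field_simp
    ring

theorem inv_h_div_le_iff {u x : ℝ} (hu : 0 < u) (hx : x ∈ Set.Ioo (0 : ℝ) 2) (hxu : h x = u⁻¹)
    {n : ℝ} (hn : 0 < n) {y : ℝ} (hy : 0 < y) (hyn : y ≤ 2 * n) :
    (h (y / n))⁻¹ ≤ u ↔ y ≤ x * n := by
  have hyn0 : 0 < y / n := div_pos hy hn
  rw [inv_le_comm₀ (h_pos hyn0) hu, ← hxu, strictAntiOn_h.le_iff_ge ⟨hx.1, hx.2.le⟩
    ⟨hyn0, (div_le_iff₀ hn).2 hyn⟩, div_le_iff₀ hn]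

end Proportional

/-! ### Thresholds for exponents above two -/

section Sublinear

variable {α : ℝ}

/-- For `α > 2` the integral is `2 * n * r ^ (1 - α) / (α - 1)` up to terms that vanish as `r → ∞`, and
the threshold is chosen to make this equal to `l`. -/
theorem isCriticalScale_of_two_lt (hα : 2 < α) {l : ℝ} (hl : 0 < l) :
    IsCriticalScale α (fun n : ℕ => (2 * n / ((α - 1) * l)) ^ (α - 1)⁻¹) l := by
  have hM := tendsto_two_mul_natCast_atTop
  have ha : 0 < α - 1 := by linarith
  have hal : 0 < (α - 1) * l := mul_pos ha hl
  set r : ℕ → ℝ := fun n => (2 * n / ((α - 1) * l)) ^ (α - 1)⁻¹ with hr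
  have hrtop : Tendsto r atTop atTop :=
    (tendsto_rpow_atTop (inv_pos.2 ha)).comp (hM.atTop_div_const hal)
  have hr0 : ∀ᶠ n in atTop, 0 < r n := hrtop.eventually_gt_atTop 0
  have hrpow : ∀ n : ℕ, (2 * n : ℝ) = (α - 1) * l * r n ^ (α - 1) := by
    intro n
    rw [hr]
    simp only
    rw [← Real.rpow_mul (by positivity), inv_mul_cancel₀ ha.ne', Real.rpow_one]
    field_simp
  have hle : ∀ᶠ n : ℕ in atTop, r n ≤ 2 * n := by
    have h1 : Tendsto (fun n => r n ^ (α - 2)) atTop atTop :=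
      (tendsto_rpow_atTop (by linarith)).comp hrtop
    filter_upwards [h1.eventually_ge_atTop ((α - 1) * l)⁻¹, hr0] with n hn hn0
    rw [hrpow, show α - 1 = 1 + (α - 2) by ring, Real.rpow_add hn0, Real.rpow_one,
      ← show α - 1 = 1 + (α - 2) by ring]
    rw [inv_le_iff_one_le_mul₀ hal] at hn
    nlinarith
  refine ⟨hrtop, hle, ?_, ?_⟩
  · have h1 := ((tendsto_inv_atTop_zero.comp hrtop).const_mul ((α - 1) * l)).sub
      ((tendsto_rpow_neg_atTop (y := α - 1) ha).comp hrtop)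
    rw [mul_zero, sub_zero] at h1
    refine h1.congr' ?_
    filter_upwards [hr0] with n hn
    simp only [Function.comp]
    rw [hrpow, sub_mul _ (r n), mul_assoc ((α - 1) * l), ← Real.rpow_add hn, ← Real.rpow_neg_one]
    congr 1
    · ring_nf
    · nth_rewrite 2 [← Real.rpow_one (r n)]
      rw [← Real.rpow_add hn]
      ring_nf
  · have hz1 : Tendsto (fun n : ℕ => (2 * n : ℝ) ^ (-(α - 2))) atTop (𝓝 0) :=
      (tendsto_rpow_neg_atTop (by linarith)).comp hM
    have hz2 : Tendsto (fun n : ℕ => r n ^ (-(α - 2))) atTop (𝓝 0) :=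
      (tendsto_rpow_neg_atTop (by linarith)).comp hrtop
    have hlim : Tendsto (fun n : ℕ => l - (2 * n : ℝ) ^ (-(α - 2)) / (α - 1) -
        (r n ^ (-(α - 2)) - (2 * n : ℝ) ^ (-(α - 2))) / (α - 2)) atTop (𝓝 l) := by
      have := ((hz1.div_const (α - 1)).const_sub l).sub ((hz2.sub hz1).div_const (α - 2))
      simpa using this
    refine hlim.congr' ?_
    filter_upwards [hr0, hle, hM.eventually_gt_atTop 0] with n hn hn2 hMn
    have hnot : (0 : ℝ) ∉ Set.uIcc (r n) (2 * n) := by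
      rw [Set.uIcc_of_le hn2]
      exact fun h => absurd h.1 (not_le.2 hn)
    have hsplit : ∫ t in r n..2 * n, (2 * n - t) * t ^ (-α) =
        2 * n * (∫ t in r n..2 * n, t ^ (-α)) - ∫ t in r n..2 * n, t ^ (1 - α) := by
      rw [← intervalIntegral.integral_const_mul, ← intervalIntegral.integral_sub]
      · refine intervalIntegral.integral_congr fun t ht => ?_
        rw [Set.uIcc_of_le hn2] at ht
        have ht0 : 0 < t := hn.trans_le ht.1
        rw [sub_eq_add_neg 1 α, Real.rpow_add ht0, Real.rpow_one]
        ring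
      · exact (intervalIntegral.intervalIntegrable_rpow (Or.inr hnot)).const_mul _
      · exact intervalIntegral.intervalIntegrable_rpow (Or.inr hnot)
    rw [hsplit, integral_rpow (Or.inr ⟨by linarith, hnot⟩),
      integral_rpow (Or.inr ⟨by linarith, hnot⟩)]
    have e1 : (2 * n : ℝ) * (2 * n : ℝ) ^ (-α + 1) = (2 * n : ℝ) ^ (-(α - 2)) := by
      nth_rewrite 1 [← Real.rpow_one (2 * n : ℝ)]
      rw [← Real.rpow_add hMn]
      ring_nf
    have e2 : (2 * n : ℝ) * r n ^ (-α + 1) = (α - 1) * l := by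
      rw [hrpow, mul_assoc, ← Real.rpow_add hn]
      simp
    have e3 : 1 - α + 1 = -(α - 2) := by ring
    rw [e3, ← mul_div_assoc, mul_sub, e1, e2]
    have h2 : α - 2 ≠ 0 := by linarith
    have h1 : -α + 1 = -(α - 1) := by ring
    rw [h1, div_neg, div_neg]
    field_simp
    ring

theorem exp_rpow_le_iff_of_two_lt (hα : 2 < α) {u : ℝ} (hu : u ∈ Set.Ioo (0 : ℝ) 1) {M x : ℝ}
    (hM : 0 < M) (hx : 0 < x) :
    Real.exp (M / (1 - α) * x ^ (1 - α)) ≤ u ↔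
      x ≤ (M / ((α - 1) * -Real.log u)) ^ (α - 1)⁻¹ := by
  have ha : 0 < α - 1 := by linarith
  have hL : 0 < -Real.log u := neg_pos.2 (Real.log_neg hu.1 hu.2)
  have e : M / (1 - α) * x ^ (1 - α) = -(M / (α - 1) / x ^ (α - 1)) := by
    rw [← neg_sub α 1, Real.rpow_neg hx.le, div_neg]
    ring
  have hp := Real.rpow_pos_of_pos hx (α - 1)
  rw [e, exp_neg_le_iff hu.1, Real.le_rpow_inv_iff_of_pos hx.le (by positivity) ha,
    le_div_iff₀ hp, ← le_div_iff₀' hL, div_div]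

end Sublinear

end SoftRGG

theorem theorem1 {Ω Ω' : Type*} [MeasurableSpace Ω] [MeasurableSpace Ω']
    (μ : Measure Ω) [IsProbabilityMeasure μ] (ν : Measure Ω') [IsProbabilityMeasure ν]
    (g : ℝ → ℝ) (hg_meas : Measurable g) (hg_mem : ∀ x, g x ∈ Set.Icc (0 : ℝ) 1)
    (hg_symm : ∀ x, g (-x) = g x)
    (α : ℝ) (hα : 0 < α)
    (hg_lim : Tendsto (fun x : ℝ => g x / |x| ^ (-α)) (comap (fun x : ℝ => |x|) atTop) (𝓝 1))
    (P : Ω → Set ℝ) (hP : SoftRGG.IsUnitPoissonProcess μ P)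
    (E : ℕ → Ω → Set (Sym2 ℝ))
    (hE : ∀ n, SoftRGG.IsSoftRandomGraph μ g (SoftRGG.window P n) (E n))
    (e : ℕ → Ω → ℝ) (he : ∀ n ω, e n ω = SoftRGG.longestEdge (E n ω))
    (U : Ω' → ℝ) (hU : pdf.IsUniform U (Set.Ioo (0 : ℝ) 1) ν volume) :
    (2 < α →
      TendstoInDistribution
        (fun (n : ℕ) ω => Real.exp (2 * n / (1 - α) * (e n ω) ^ (1 - α)))
        atTop U (fun _ => μ) ν) ∧
    (α = 2 →
      TendstoInDistribution
        (fun (n : ℕ) ω => (SoftRGG.h (e n ω / n))⁻¹)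
        atTop U (fun _ => μ) ν) ∧
    (1 < α → α < 2 →
      TendstoInDistribution
        (fun (n : ℕ) ω => Real.exp (-((2 * n : ℝ) ^ (α - 2) * 2⁻¹ * ((2 - α) ^ 2)⁻¹ *
          ((e n ω) ^ (2 - α) - (2 * n : ℝ) ^ (2 - α)) ^ 2)))
        atTop U (fun _ => μ) ν) ∧
    (α = 1 →
      TendstoInDistribution
        (fun (n : ℕ) ω => Real.exp (-(n * (Real.log (e n ω / (2 * n))) ^ 2)))
        atTop U (fun _ => μ) ν) ∧
    (α < 1 →
      TendstoInDistribution
        (fun (n : ℕ) ω => Real.exp (-((2 * n : ℝ) ^ α * 2⁻¹ * ((1 - α) ^ 2)⁻¹ *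
          ((e n ω) ^ (1 - α) - (2 * n : ℝ) ^ (1 - α)) ^ 2)))
        atTop U (fun _ => μ) ν) := by
  obtain rfl : e = fun n ω => SoftRGG.longestEdge (E n ω) := funext fun n => funext (he n)
  have hlim := SoftRGG.tendsto_div_rpow_neg_atTop hg_lim
  have main := fun (φ : ℕ → ℝ → ℝ) (hφ : ∀ n, Measurable (φ n)) =>
    SoftRGG.tendstoInDistribution_of_isCriticalScale hP hg_meas hg_mem hg_symm hα hlim hE hU hφ
  have hM := SoftRGG.tendsto_two_mul_natCast_atTop
  have hL : ∀ u ∈ Set.Ioo (0 : ℝ) 1, 0 < -Real.log u := fun u hu =>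
    neg_pos.2 (Real.log_neg hu.1 hu.2)
  -- the two regimes below `2` other than `α = 1` differ only in the exponent `q` of `e n ω`
  have hpow : α < 2 → ∀ q : ℝ, 0 < q → ∀ A : ℕ → ℝ,
      (∀ n : ℕ, 0 < (2 * n : ℝ) →
        A n * ((2 * n : ℝ) ^ q) ^ 2 = ((2 * n : ℝ) ^ (1 - α / 2)) ^ 2) →
      TendstoInDistribution (fun (n : ℕ) ω => Real.exp (-(A n * 2⁻¹ * (q ^ 2)⁻¹ *
        (SoftRGG.longestEdge (E n ω) ^ q - (2 * n : ℝ) ^ q) ^ 2))) atTop U (fun _ => μ) ν := by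
    intro hα2 q hq A hA
    refine main (fun n x => Real.exp (-(A n * 2⁻¹ * (q ^ 2)⁻¹ *
      (x ^ q - (2 * n : ℝ) ^ q) ^ 2))) (fun n => by fun_prop) fun u hu => ?_
    have hscale := SoftRGG.isCriticalScale_of_hasDerivAt hα hα2
      (SoftRGG.hasDerivAt_one_sub_mul_rpow_inv hq) (by simp)
      (Real.sqrt_pos.2 (mul_pos two_pos (hL u hu)))
    rw [Real.sq_sqrt (by linarith [hL u hu]), mul_div_cancel_left₀ _ two_ne_zero] at hscale
    refine ⟨_, hscale, ?_⟩
    have hw : Tendsto (fun n : ℕ => (2 * n : ℝ) ^ (1 - α / 2)) atTop atTop :=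
      (tendsto_rpow_atTop (by linarith)).comp hM
    have hsmall : Tendsto (fun n : ℕ => 1 - q * (√(2 * -Real.log u) / (2 * n : ℝ) ^ (1 - α / 2)))
        atTop (𝓝 1) := by
      simpa using ((hw.const_div_atTop (√(2 * -Real.log u))).const_mul q).const_sub 1
    filter_upwards [hM.eventually_gt_atTop 0, hsmall.eventually_const_lt one_pos]
      with n hn hn1 x hx hxn
    exact SoftRGG.exp_rpow_transform_le_iff hu hq hn (Real.rpow_pos_of_pos hn _) (hA n hn)
      hn1.le hx hxn
  refine ⟨fun hα2 => ?_, fun hα2 => ?_, fun hα1 hα2 => ?_, fun hα1 => ?_, fun hα1 => ?_⟩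
  · refine main (fun n x => Real.exp (2 * n / (1 - α) * x ^ (1 - α))) (fun n => by fun_prop)
      fun u hu => ⟨_, SoftRGG.isCriticalScale_of_two_lt hα2 (hL u hu), ?_⟩
    filter_upwards [hM.eventually_gt_atTop 0] with n hn x hx _
    exact SoftRGG.exp_rpow_le_iff_of_two_lt hα2 hu hn hx
  · subst hα2
    refine main (fun n x => (SoftRGG.h (x / n))⁻¹) (fun n => ?_) fun u hu => ?_
    · unfold SoftRGG.h
      fun_prop
    obtain ⟨x, hx, hxu⟩ := SoftRGG.exists_h_eq ((one_lt_inv₀ hu.1).2 hu.2)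
    have hscale := SoftRGG.isCriticalScale_two hx
    rw [hxu, Real.log_inv] at hscale
    refine ⟨_, hscale, ?_⟩
    filter_upwards [eventually_gt_atTop 0] with n hn y hy hyn
    exact SoftRGG.inv_h_div_le_iff hu.1 hx hxu (Nat.cast_pos.2 hn) hy hyn
  · refine hpow hα2 (2 - α) (by linarith) (fun n => (2 * n : ℝ) ^ (α - 2)) fun n hn => ?_
    rw [← Real.rpow_mul_natCast hn.le, ← Real.rpow_mul_natCast hn.le, ← Real.rpow_add hn]
    push_cast
    ring_nf
  · subst hα1
    refine main (fun n x => Real.exp (-(n * (Real.log (x / (2 * n))) ^ 2)))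
      (fun n => by fun_prop) fun u hu => ?_
    have hscale := SoftRGG.isCriticalScale_of_hasDerivAt one_pos one_lt_two
      SoftRGG.hasDerivAt_exp_neg_zero (by simp) (Real.sqrt_pos.2 (mul_pos two_pos (hL u hu)))
    rw [Real.sq_sqrt (by linarith [hL u hu]), mul_div_cancel_left₀ _ two_ne_zero] at hscale
    refine ⟨_, hscale, ?_⟩
    filter_upwards [hM.eventually_gt_atTop 0] with n hn x hx hxn
    have hw : (2 * n : ℝ) = ((2 * n : ℝ) ^ (1 - 1 / 2 : ℝ)) ^ 2 := by
      rw [← Real.rpow_mul_natCast hn.le]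
      norm_num
    have key := SoftRGG.exp_log_transform_le_iff hu hn (Real.rpow_pos_of_pos hn _) hw hx hxn
    rwa [mul_div_cancel_left₀ _ two_ne_zero] at key
  · refine hpow (by linarith) (1 - α) (by linarith) (fun n => (2 * n : ℝ) ^ α) fun n hn => ?_
    rw [← Real.rpow_mul_natCast hn.le, ← Real.rpow_mul_natCast hn.le, ← Real.rpow_add hn]
    push_cast
    ring_nf
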